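/- Let $\mathcal H$ be the Bargmann space of entire functions in $L^2(\mathbb C,\pi^{-1}e^{-|z|^2}\,dx\,dy)$ and $\Phi_n(z)=z^n/\sqrt{n!}$, $n\ge 0$. Let $a^-$ and $a^+$ be the closed linear operators in $\mathcal H$ obtained by taking the closures of the linear operators on $\mathrm{span}\{\Phi_n\}$ with $a^-\Phi_0=0$, $a^-\Phi_{n+1}=\sqrt{n+1}\,\Phi_n$ and $a^+\Phi_n=\sqrt{n+1}\,\Phi_{n+1}$. For $\xi\in\mathbb C$ put $K_+=\tfrac12z^2$, $K_-=\tfrac12\partial_z^2$, and $\zeta=\frac{\tanh|\xi|}{|\xi|}\,\xi$ (with $\zeta=0$ if $\xi=0$). (0) There is exactly one strongly continuous one-parameter unitary group $(U_t)_{t\in\mathbb R}$ on $\mathcal H$ with $\frac{d}{dt}U_tp\,|_{t=0}=(\xi K_+-\bar\xi K_-)p$ in the norm of $\mathcal H$ for every polynomial $p$. The squeeze operator is $S(\xi)=e^{\xi K_+-\bar\xi K_-}:=U_1$. Set $\Phi_n^\xi=S(\xi)\Phi_n$ and $a^\mp_\xi=S(\xi)\,a^\mp S(-\xi)$, with domain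 $\{f\in\mathcal H: S(-\xi)f\in\mathrm{dom}\,a^\mp\}$. (1) For every $n\ge 0$ the vector $\Phi_n^\xi$ lies in the domains of $a^-_\xi$ and $a^+_\xi$, and $$a^-_\xi\Phi_0^\xi=0,\qquad a^-_\xi\Phi_{n+1}^\xi=\sqrt{n+1}\,\Phi_n^\xi,\qquad a^+_\xi\Phi_n^\xi=\sqrt{n+1}\,\Phi_{n+1}^\xi .$$ (2) As operators in $\mathcal H$, $$a^-_\xi=\frac{1}{\sqrt{1-|\zeta|^2}}\,(\partial_z-\zeta z),\qquad a^+_\xi=\frac{1}{\sqrt{1-|\zeta|^2}}\,(z-\bar\zeta\,\partial_z),$$ where each right-hand side has its maximal domain, that is, all $f\in\mathcal H$ which the differential expression maps into $\mathcal H$; the equalities include equality of domains. (3) For every $n\ge 0$ and $z\in\mathbb C$, $$\Phi_n^\xi(z)=\frac{1}{\sqrt{n!\,(1-|\zeta|^2)^n}}\,\bigl[(z-\bar\zeta\,\partial_z)^n\,\Phi_0^\xi\bigr](z),\qquad \Phi_0^\xi(z)=(1-|\zeta|^2)^{1/4}\,e^{\zeta z^2/2}.$$ -/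

import Mathlib

open MeasureTheory Complex ComplexConjugate

noncomputable section

namespace Squeezed

/-- The Gaussian measure `π⁻¹ e^{-|z|²} dx dy` on `ℂ`. -/
def bargmannMeasure : Measure ℂ :=
  (volume : Measure ℂ).withDensity (fun z => ENNReal.ofReal (Real.pi⁻¹ * Real.exp (-‖z‖ ^ 2)))

theorem ae_volume_of_ae_bargmannMeasure {p : ℂ → Prop} (h : ∀ᵐ z ∂bargmannMeasure, p z) :
    ∀ᵐ z ∂(volume : Measure ℂ), p z := by
  have hac : (volume : Measure ℂ) ≪ bargmannMeasure := by
    refine withDensity_absolutelyContinuous' ?_ ?_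
    · refine Measurable.aemeasurable ?_
      fun_prop
    · refine Filter.Eventually.of_forall fun z => ?_
      simp only [ne_eq, ENNReal.ofReal_eq_zero, not_le]
      positivity
  exact hac.ae_le h

/-- The entire functions that are square integrable for the Gaussian measure. -/
def bargmannSubmodule : Submodule ℂ (ℂ → ℂ) where
  carrier := {F | Differentiable ℂ F ∧ MemLp F 2 bargmannMeasure}
  zero_mem' := ⟨differentiable_const (0 : ℂ), MemLp.zero⟩
  add_mem' := fun hF hG => ⟨hF.1.add hG.1, hF.2.add hG.2⟩
  smul_mem' := fun c _ hF => ⟨hF.1.const_smul c, hF.2.const_smul c⟩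

/-- The Bargmann space of entire functions. -/
def Bargmann : Type := ↥bargmannSubmodule

namespace Bargmann

instance : AddCommGroup Bargmann := inferInstanceAs (AddCommGroup ↥bargmannSubmodule)

instance : Module ℂ Bargmann := inferInstanceAs (Module ℂ ↥bargmannSubmodule)

/-- The entire function underlying an element of the Bargmann space. -/
def toFun (f : Bargmann) : ℂ → ℂ := Subtype.val f

instance : CoeFun Bargmann (fun _ => ℂ → ℂ) := ⟨toFun⟩

theorem differentiable (f : Bargmann) : Differentiable ℂ f := (Subtype.property f).1

theorem memLp (f : Bargmann) : MemLp f 2 bargmannMeasure := (Subtype.property f).2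

theorem ext {f g : Bargmann} (h : ∀ z, f z = g z) : f = g := Subtype.ext (funext h)

/-- An entire square integrable function, as an element of the Bargmann space. -/
def mk (F : ℂ → ℂ) (hF : F ∈ bargmannSubmodule) : Bargmann := ⟨F, hF⟩

@[simp] theorem mk_apply (F : ℂ → ℂ) (hF : F ∈ bargmannSubmodule) (z : ℂ) :
    (mk F hF) z = F z := rfl

@[simp] theorem add_apply (f g : Bargmann) (z : ℂ) : (f + g) z = f z + g z := rfl

@[simp] theorem smul_apply (c : ℂ) (f : Bargmann) (z : ℂ) : (c • f) z = c * f z := rfl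

theorem coe_add (f g : Bargmann) : (f + g).toFun = f.toFun + g.toFun := rfl

theorem coe_smul (c : ℂ) (f : Bargmann) : (c • f).toFun = c • f.toFun := rfl

/-- The inclusion of the Bargmann space into `L²(ℂ, π⁻¹ e^{-|z|²} dx dy)`. -/
def toLp : Bargmann →ₗ[ℂ] Lp ℂ 2 bargmannMeasure where
  toFun f := f.memLp.toLp f
  map_add' f g := MemLp.toLp_add f.memLp g.memLp
  map_smul' c f := MemLp.toLp_const_smul c f.memLp

theorem toLp_injective : Function.Injective toLp := by
  intro f g h
  have h1 : (f : ℂ → ℂ) =ᵐ[bargmannMeasure] g := (MemLp.toLp_eq_toLp_iff f.memLp g.memLp).1 h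
  have h2 : (f : ℂ → ℂ) =ᵐ[volume] g := ae_volume_of_ae_bargmannMeasure h1
  have h3 : (f : ℂ → ℂ) = g :=
    (Continuous.ae_eq_iff_eq volume f.differentiable.continuous g.differentiable.continuous).1 h2
  exact ext fun z => congrFun h3 z

/-- The norm of the Bargmann space is the one of `L²`. -/
instance : NormedAddCommGroup Bargmann :=
  NormedAddCommGroup.induced Bargmann (Lp ℂ 2 bargmannMeasure) toLp toLp_injective

/-- The inner product of the Bargmann space is the one of `L²`, antilinear in the first slot. -/
instance : InnerProductSpace ℂ Bargmann where
  inner f g := inner ℂ (toLp f) (toLp g)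
  norm_smul_le c f := by
    change ‖toLp (c • f)‖ ≤ ‖c‖ * ‖toLp f‖
    rw [map_smul, norm_smul]
  norm_sq_eq_re_inner f := norm_sq_eq_re_inner (𝕜 := ℂ) (toLp f)
  conj_inner_symm f g := inner_conj_symm (toLp f) (toLp g)
  add_left f g h := by
    change inner ℂ (toLp (f + g)) (toLp h) = _
    rw [map_add, inner_add_left]
  smul_left f g c := by
    change inner ℂ (toLp (c • f)) (toLp g) = _
    rw [map_smul, inner_smul_left]

end Bargmann

theorem monomial_mem (n : ℕ) : (fun z : ℂ => z ^ n) ∈ bargmannSubmodule := by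
  refine ⟨differentiable_pow n, ?_⟩
  have hcont : Continuous fun z : ℂ => z ^ n := by fun_prop
  rw [memLp_two_iff_integrable_sq_norm hcont.aestronglyMeasurable]
  have hdens : Measurable fun z : ℂ => ENNReal.ofReal (Real.pi⁻¹ * Real.exp (-‖z‖ ^ 2)) := by
    fun_prop
  rw [bargmannMeasure, integrable_withDensity_iff hdens
    (Filter.Eventually.of_forall fun z => ENNReal.ofReal_lt_top)]
  have hg : Integrable (fun z : ℂ => Real.exp (-(1 / 2) * ‖z‖ ^ 2)) := by
    have h := (GaussianFourier.integrable_cexp_neg_mul_sq_norm_add (V := ℂ) (b := 1 / 2)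
      (by norm_num) 0 0).norm
    refine h.congr (Filter.Eventually.of_forall fun z => ?_)
    simp only [Complex.norm_exp]
    congr 1
    simp [pow_two]
  refine (hg.const_mul (Real.pi⁻¹ * (2 ^ n * n.factorial))).mono'
    (Continuous.aestronglyMeasurable ?_) (Filter.Eventually.of_forall fun z => ?_)
  · simp only [ENNReal.toReal_ofReal (show 0 ≤ Real.pi⁻¹ * Real.exp (-‖_‖ ^ 2) by positivity)]
    fun_prop
  · rw [ENNReal.toReal_ofReal (by positivity), Real.norm_of_nonneg (by positivity), norm_pow]
    have h1 := Real.pow_div_factorial_le_exp (‖z‖ ^ 2 / 2) (by positivity) n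
    have hn : (0 : ℝ) < n.factorial := by positivity
    rw [div_le_iff₀ hn, div_pow, div_le_iff₀ (by positivity)] at h1
    have h2 : Real.exp (-‖z‖ ^ 2) = Real.exp (-(1 / 2) * ‖z‖ ^ 2) * Real.exp (-(‖z‖ ^ 2 / 2)) := by
      rw [← Real.exp_add]; ring_nf
    have h3 : Real.exp (‖z‖ ^ 2 / 2) * Real.exp (-(‖z‖ ^ 2 / 2)) = 1 := by
      rw [← Real.exp_add]; simp
    calc (‖z‖ ^ n) ^ 2 * (Real.pi⁻¹ * Real.exp (-‖z‖ ^ 2))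
        = (‖z‖ ^ 2) ^ n * (Real.pi⁻¹ * Real.exp (-‖z‖ ^ 2)) := by rw [← pow_mul, ← pow_mul, mul_comm n]
      _ ≤ (Real.exp (‖z‖ ^ 2 / 2) * n.factorial * 2 ^ n) * (Real.pi⁻¹ * Real.exp (-‖z‖ ^ 2)) := by
          gcongr
      _ = Real.pi⁻¹ * (2 ^ n * n.factorial) * Real.exp (-(1 / 2) * ‖z‖ ^ 2) *
            (Real.exp (‖z‖ ^ 2 / 2) * Real.exp (-(‖z‖ ^ 2 / 2))) := by rw [h2]; ring
      _ = Real.pi⁻¹ * (2 ^ n * n.factorial) * Real.exp (-(1 / 2) * ‖z‖ ^ 2) := by rw [h3, mul_one]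

theorem polynomial_mem (p : Polynomial ℂ) : (fun z : ℂ => p.eval z) ∈ bargmannSubmodule := by
  have h : (fun z : ℂ => p.eval z) =
      ∑ n ∈ Finset.range (p.natDegree + 1), p.coeff n • fun z : ℂ => z ^ n := by
    funext z
    simp [Polynomial.eval_eq_sum_range]
  rw [h]
  exact Submodule.sum_mem _ fun n _ => Submodule.smul_mem _ _ (monomial_mem n)

/-- A polynomial as an element of the Bargmann space. -/
def ofPoly (p : Polynomial ℂ) : Bargmann := Bargmann.mk (fun z => p.eval z) (polynomial_mem p)

/-- The Fock-Bargmann basis vector `Φₙ(z) = zⁿ / √(n!)`. -/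
def Φ (n : ℕ) : Bargmann :=
  Bargmann.mk (fun z => ((Real.sqrt n.factorial : ℝ) : ℂ)⁻¹ * z ^ n)
    (Submodule.smul_mem _ _ (monomial_mem n))

/-- `K₊ = z² / 2` on polynomials. -/
def Kplus (p : Polynomial ℂ) : Polynomial ℂ := (1 / 2 : ℂ) • (Polynomial.X ^ 2 * p)

/-- `K₋ = ∂² / 2` on polynomials. -/
def Kminus (p : Polynomial ℂ) : Polynomial ℂ :=
  (1 / 2 : ℂ) • Polynomial.derivative (Polynomial.derivative p)

/-- `U` is the strongly continuous one-parameter unitary group `t ↦ exp (t (ξ K₊ - ξ̄ K₋))`: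
its infinitesimal generator is `ξ K₊ - ξ̄ K₋` on the polynomials. -/
structure IsSqueezeGroup (ξ : ℂ) (U : ℝ → Bargmann ≃ₗᵢ[ℂ] Bargmann) : Prop where
  zero : U 0 = 1
  add : ∀ s t : ℝ, U (s + t) = U s * U t
  continuous : ∀ f : Bargmann, Continuous fun t : ℝ => U t f
  generator : ∀ p : Polynomial ℂ,
    HasDerivAt (fun t : ℝ => U t (ofPoly p)) (ofPoly (ξ • Kplus p - conj ξ • Kminus p)) 0

open Classical in
/-- The squeeze operator `S(ξ) = exp (ξ K₊ - ξ̄ K₋)`: the value at time `1` of the one-parameter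
unitary group generated by `ξ K₊ - ξ̄ K₋` (the identity, should there be no such group). -/
def S (ξ : ℂ) : Bargmann ≃ₗᵢ[ℂ] Bargmann :=
  if h : ∃ U : ℝ → Bargmann ≃ₗᵢ[ℂ] Bargmann, IsSqueezeGroup ξ U then h.choose 1 else 1

/-- The squeezed basis `Φₙ^ξ = S(ξ) Φₙ`. -/
def squeezedBasis (ξ : ℂ) (n : ℕ) : Bargmann := S ξ (Φ n)

/-- The lowering operator `a⁻`: the closed operator determined by `a⁻ Φₙ = √n Φₙ₋₁`
(whose right-hand side is `0` for `n = 0`). -/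
def lowering : Bargmann →ₗ.[ℂ] Bargmann :=
  (Submodule.span ℂ (Set.range fun n : ℕ =>
    ((Φ n, ((Real.sqrt n : ℝ) : ℂ) • Φ (n - 1)) : Bargmann × Bargmann))).topologicalClosure.toLinearPMap

/-- The raising operator `a⁺`: the closed operator determined by `a⁺ Φₙ = √(n+1) Φₙ₊₁`. -/
def raising : Bargmann →ₗ.[ℂ] Bargmann :=
  (Submodule.span ℂ (Set.range fun n : ℕ =>
    ((Φ n, ((Real.sqrt (n + 1) : ℝ) : ℂ) • Φ (n + 1)) : Bargmann × Bargmann))).topologicalClosure.toLinearPMap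

/-- The operator `S(ξ) T S(-ξ)`, with domain `{f | S(-ξ) f ∈ dom T}`. -/
def squeeze (ξ : ℂ) (T : Bargmann →ₗ.[ℂ] Bargmann) : Bargmann →ₗ.[ℂ] Bargmann where
  domain := T.domain.comap ((S (-ξ)).toLinearEquiv : Bargmann →ₗ[ℂ] Bargmann)
  toFun := ((S ξ).toLinearEquiv : Bargmann →ₗ[ℂ] Bargmann) ∘ₗ T.toFun ∘ₗ
    LinearMap.restrict ((S (-ξ)).toLinearEquiv : Bargmann →ₗ[ℂ] Bargmann) (fun _ h => h)

/-- The differential expression `f ↦ α f' + β z f`. -/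
def diffExpr (α β : ℂ) : Bargmann →ₗ[ℂ] (ℂ → ℂ) where
  toFun f := fun z => α * deriv f z + β * z * f z
  map_add' f g := by
    funext z
    simp only [Bargmann.coe_add, deriv_add (f.differentiable z) (g.differentiable z), Pi.add_apply]
    ring
  map_smul' c f := by
    funext z
    simp only [Bargmann.coe_smul, deriv_const_smul c (f.differentiable z), Pi.smul_apply,
      smul_eq_mul, RingHom.id_apply]
    ring

/-- The operator `α ∂_z + β z` in the Bargmann space, with its maximal domain: those `f` for which
the entire function `α f' + β z f` lies in the Bargmann space. -/
def diffOp (α β : ℂ) : Bargmann →ₗ.[ℂ] Bargmann where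
  domain := bargmannSubmodule.comap (diffExpr α β)
  toFun := LinearMap.restrict (diffExpr α β) (fun _ h => h)

/-- `ζ = (tanh |ξ| / |ξ|) ξ`, which is `0` for `ξ = 0`. -/
def zeta (ξ : ℂ) : ℂ := ((Real.tanh ‖ξ‖ / ‖ξ‖ : ℝ) : ℂ) * ξ

end Squeezed

end

open Squeezed

noncomputable section

namespace Squeezed

open Filter Topology

/-! ### Inner product as an integral, and convergence in norm. -/

namespace Bargmann

/-! The squeeze group is explicit on the coherent states `e^{wz}`. With `ζ_t = (tanh(t|ξ|)/|ξ|) ξ`,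
the Gaussian `cosh(t|ξ|)^{-1/2} exp(-ζ̄_t w²/2 + wz/cosh(t|ξ|) + ζ_t z²/2)` starts at `e^{wz}` and
solves `u' = (ξK₊ - ξ̄K₋)u` in norm (`hasDerivAt_orbit`); the `z²` coefficient gives the Riccati
equation `ζ' = ξ - ξ̄ζ²`. Because `|ζ_t| < 1`, everything takes place among entire functions of
Gaussian growth strictly below the weight, where `z` and `∂_z` preserve the class and are adjoint,
so the generator is skew-symmetric.

Existence: skew-symmetry makes the Gram matrix of the orbits invariant under a common time shift, so
the orbits of the total family of coherent states extend to a unitary group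
(`exists_unitary_group`). Its derivative on polynomials follows from an integral equation tested
against coherent states. Uniqueness: Taylor polynomials approximate a tame function together with
its image under the generator, so for any admissible group `V` the pairing of `V_t p` with the orbit
is constant in `t`. This forces `V_t` to carry `e^{wz}` to the orbit
(`IsSqueezeGroup.apply_coherent`).

Operators: by the reproducing property, `S(ξ)f(v)` is the pairing of `f` with a squeezed coherent
state. Moving `α∂_z + βz` across this pairing shows that `S(ξ)` acts on first order operators by an
invertible linear substitution in `(α, β)`. Truncating Taylor series identifies the closures `a⁻`
and `a⁺` with `∂_z` and `z` on maximal domains; using the substitution for both `ξ` and `-ξ` then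
gives equality of domains (`squeeze_eq_diffOp`). The formulas for the squeezed basis are images of
`zΦ_n = √(n+1) Φ_{n+1}` and of `Φ_0 = e^{0·z}`. -/

theorem inner_eq_integral (f g : Bargmann) :
    inner ℂ f g = ∫ z, conj (f z) * g z ∂bargmannMeasure := by
  change inner ℂ (toLp f) (toLp g) = _
  rw [L2.inner_def]
  refine integral_congr_ae ?_
  filter_upwards [f.memLp.coeFn_toLp, g.memLp.coeFn_toLp] with z h1 h2
  change inner ℂ ((f.memLp.toLp f : Lp ℂ 2 bargmannMeasure) z)
    ((g.memLp.toLp g : Lp ℂ 2 bargmannMeasure) z) = _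
  rw [h1, h2, RCLike.inner_apply, mul_comm]

theorem norm_sq_eq_integral (f : Bargmann) :
    ‖f‖ ^ 2 = ∫ z, ‖f z‖ ^ 2 ∂bargmannMeasure := by
  have h : ((‖f‖ ^ 2 : ℝ) : ℂ) = ((∫ z, ‖f z‖ ^ 2 ∂bargmannMeasure : ℝ) : ℂ) := by
    have h1 := inner_self_eq_norm_sq_to_K (𝕜 := ℂ) f
    rw [inner_eq_integral] at h1
    rw [← integral_complex_ofReal]
    push_cast
    refine h1.symm.trans (integral_congr_ae (Eventually.of_forall fun z => ?_))
    simp only [conj_mul']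
  exact_mod_cast h

theorem sub_apply (f g : Bargmann) (z : ℂ) : (f - g) z = f z - g z := rfl

theorem zero_apply (z : ℂ) : (0 : Bargmann) z = 0 := rfl

theorem sum_apply {ι : Type*} (s : Finset ι) (f : ι → Bargmann) (z : ℂ) :
    (∑ i ∈ s, f i) z = ∑ i ∈ s, f i z := by
  classical
  induction s using Finset.induction_on with
  | empty => rfl
  | insert a s ha ih => rw [Finset.sum_insert ha, Finset.sum_insert ha, add_apply, ih]

/-- Dominated convergence in the Bargmann space. -/
theorem tendsto_of_dominated {ι : Type*} {l : Filter ι} [l.IsCountablyGenerated] [l.NeBot]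
    {G : ι → Bargmann} {g : Bargmann} {D : ℂ → ℝ} (hD : MemLp D 2 bargmannMeasure)
    (hb : ∀ᶠ i in l, ∀ z, ‖G i z‖ ≤ D z) (hlim : ∀ z, Tendsto (fun i => G i z) l (𝓝 (g z))) :
    Tendsto G l (𝓝 g) := by
  rw [tendsto_iff_norm_sub_tendsto_zero]
  have hg : ∀ z, ‖g z‖ ≤ D z := fun z =>
    le_of_tendsto (hlim z).norm (hb.mono fun i hi => hi z)
  have key : Tendsto (fun i => ‖G i - g‖ ^ 2) l (𝓝 0) := by
    have h := tendsto_integral_filter_of_dominated_convergence (μ := bargmannMeasure) (l := l)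
      (F := fun i z => ‖(G i - g) z‖ ^ 2) (f := fun _ => (0 : ℝ)) (fun z => (2 * D z) ^ 2)
      (Eventually.of_forall fun i =>
        ((G i - g).differentiable.continuous.norm.pow 2).aestronglyMeasurable)
      (hb.mono fun i hi => Eventually.of_forall fun z => ?_)
      ((hD.const_mul 2).integrable_sq) (Eventually.of_forall fun z => ?_)
    · simpa only [norm_sq_eq_integral, integral_zero] using h
    · rw [Real.norm_of_nonneg (by positivity), sub_apply]
      gcongr
      linarith [norm_sub_le (G i z) (g z), hi z, hg z]
    · have h1 := (tendsto_iff_norm_sub_tendsto_zero.1 (hlim z)).pow 2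
      simpa [sub_apply] using h1
  have h2 := key.sqrt
  simpa [Real.sqrt_sq] using h2

end Bargmann

/-! ### Entire functions of subcritical Gaussian growth. -/

/-- The Gaussian majorants `K e^{K |z| + ρ |z|² / 2}`. -/
def majorant (K ρ : ℝ) (z : ℂ) : ℝ := K * Real.exp (K * ‖z‖ + ρ * ‖z‖ ^ 2 / 2)

theorem integrable_bargmannMeasure_iff {f : ℂ → ℝ} :
    Integrable f bargmannMeasure ↔
      Integrable (fun z : ℂ => f z * (Real.pi⁻¹ * Real.exp (-‖z‖ ^ 2))) := by
  have hdens : Measurable fun z : ℂ => ENNReal.ofReal (Real.pi⁻¹ * Real.exp (-‖z‖ ^ 2)) := by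
    fun_prop
  rw [bargmannMeasure, integrable_withDensity_iff hdens
    (Eventually.of_forall fun z => ENNReal.ofReal_lt_top)]
  refine integrable_congr (Eventually.of_forall fun z => ?_)
  simp only
  rw [ENNReal.toReal_ofReal (by positivity)]

theorem integrable_exp_neg_mul_norm_sq {b : ℝ} (hb : 0 < b) :
    Integrable (fun z : ℂ => Real.exp (-b * ‖z‖ ^ 2)) := by
  have h := (GaussianFourier.integrable_cexp_neg_mul_sq_norm_add (V := ℂ) (b := b)
      (by simpa using hb) 0 0).norm
  refine h.congr (Eventually.of_forall fun z => ?_)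
  simp only [Complex.norm_exp]
  congr 1
  simp [pow_two]

theorem continuous_majorant (K ρ : ℝ) : Continuous (majorant K ρ) := by
  unfold majorant; fun_prop

theorem memLp_majorant (K : ℝ) {ρ : ℝ} (hρ : ρ < 1) :
    MemLp (majorant K ρ) 2 bargmannMeasure := by
  rw [memLp_two_iff_integrable_sq (continuous_majorant K ρ).aestronglyMeasurable,
    integrable_bargmannMeasure_iff]
  set δ := (1 - ρ) / 2 with hδ
  have hδ0 : 0 < δ := by rw [hδ]; linarith
  refine ((integrable_exp_neg_mul_norm_sq hδ0).const_mul
    (K ^ 2 * Real.pi⁻¹ * Real.exp (K ^ 2 / δ))).mono'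
    (Continuous.aestronglyMeasurable ?_) (Eventually.of_forall fun z => ?_)
  · have := continuous_majorant K ρ
    fun_prop
  · rw [Real.norm_of_nonneg (by positivity)]
    have h1 : majorant K ρ z ^ 2 * (Real.pi⁻¹ * Real.exp (-‖z‖ ^ 2)) =
        K ^ 2 * Real.pi⁻¹ * Real.exp (2 * K * ‖z‖ + (ρ - 1) * ‖z‖ ^ 2) := by
      have : Real.exp (2 * K * ‖z‖ + (ρ - 1) * ‖z‖ ^ 2) =
          Real.exp (K * ‖z‖ + ρ * ‖z‖ ^ 2 / 2) ^ 2 * Real.exp (-‖z‖ ^ 2) := by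
        rw [← Real.exp_nat_mul, ← Real.exp_add]
        congr 1
        push_cast
        ring
      rw [this, majorant]
      ring
    rw [h1, mul_assoc (K ^ 2 * Real.pi⁻¹), ← Real.exp_add]
    refine mul_le_mul_of_nonneg_left (Real.exp_le_exp.2 ?_) (by positivity)
    -- Completing the square absorbs the linear term into half of the Gaussian gap `1 - ρ = 2δ`.
    have h2 : 0 ≤ (K - δ * ‖z‖) ^ 2 / δ := by positivity
    have h3 : (K - δ * ‖z‖) ^ 2 / δ = K ^ 2 / δ - 2 * K * ‖z‖ + δ * ‖z‖ ^ 2 := by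
      field_simp
      ring
    have h4 : ρ - 1 = - 2 * δ := by rw [hδ]; ring
    rw [h4]
    linarith

/-- Entire functions of Gaussian growth with exponent below that of the weight. -/
def Tame (F : ℂ → ℂ) : Prop :=
  Differentiable ℂ F ∧ ∃ K ρ : ℝ, 0 ≤ K ∧ 0 ≤ ρ ∧ ρ < 1 ∧ ∀ z, ‖F z‖ ≤ majorant K ρ z

theorem majorant_add {K K' ρ ρ' : ℝ} (h0 : 0 ≤ K) (h0' : 0 ≤ K') (z : ℂ) :
    majorant K ρ z + majorant K' ρ' z ≤ majorant (K + K') (max ρ ρ') z := by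
  have h1 : majorant K ρ z ≤ K * Real.exp ((K + K') * ‖z‖ + max ρ ρ' * ‖z‖ ^ 2 / 2) := by
    unfold majorant
    gcongr
    · linarith
    · exact le_max_left _ _
  have h2 : majorant K' ρ' z ≤ K' * Real.exp ((K + K') * ‖z‖ + max ρ ρ' * ‖z‖ ^ 2 / 2) := by
    unfold majorant
    gcongr
    · linarith
    · exact le_max_right _ _
  calc _ ≤ _ := add_le_add h1 h2
    _ = _ := by unfold majorant; ring

theorem norm_mul_majorant {K ρ : ℝ} (h0 : 0 ≤ K) (z : ℂ) :
    ‖z‖ * majorant K ρ z ≤ majorant (K + 1) ρ z := by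
  unfold majorant
  have h1 : ‖z‖ ≤ Real.exp ‖z‖ := (by linarith : ‖z‖ ≤ ‖z‖ + 1).trans (Real.add_one_le_exp _)
  calc ‖z‖ * (K * Real.exp (K * ‖z‖ + ρ * ‖z‖ ^ 2 / 2))
      ≤ Real.exp ‖z‖ * ((K + 1) * Real.exp (K * ‖z‖ + ρ * ‖z‖ ^ 2 / 2)) := by
        gcongr
        linarith
    _ = (K + 1) * (Real.exp ‖z‖ * Real.exp (K * ‖z‖ + ρ * ‖z‖ ^ 2 / 2)) := by ring
    _ = _ := by rw [← Real.exp_add]; ring_nf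

namespace Tame

variable {F G : ℂ → ℂ}

theorem mem (h : Tame F) : F ∈ bargmannSubmodule := by
  obtain ⟨hd, K, ρ, -, -, hρ, hb⟩ := h
  exact ⟨hd, (memLp_majorant K hρ).mono' hd.continuous.aestronglyMeasurable
    (Eventually.of_forall hb)⟩

theorem add (hF : Tame F) (hG : Tame G) : Tame fun z => F z + G z := by
  obtain ⟨hd, K, ρ, hK, h0, hρ, hb⟩ := hF
  obtain ⟨hd', K', ρ', hK', h0', hρ', hb'⟩ := hG
  refine ⟨hd.add hd', K + K', max ρ ρ', by positivity, le_max_of_le_left h0, max_lt hρ hρ',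
    fun z => ?_⟩
  exact (norm_add_le _ _).trans ((add_le_add (hb z) (hb' z)).trans (majorant_add hK hK' z))

theorem const_mul (c : ℂ) (hF : Tame F) : Tame fun z => c * F z := by
  obtain ⟨hd, K, ρ, hK, h0, hρ, hb⟩ := hF
  refine ⟨hd.const_mul c, (1 + ‖c‖) * K, ρ, by positivity, h0, hρ, fun z => ?_⟩
  rw [norm_mul]
  calc ‖c‖ * ‖F z‖ ≤ (1 + ‖c‖) * majorant K ρ z := by
        gcongr
        · linarith
        · exact hb z
    _ = (1 + ‖c‖) * K * Real.exp (K * ‖z‖ + ρ * ‖z‖ ^ 2 / 2) := by unfold majorant; ring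
    _ ≤ _ := by
        unfold majorant
        gcongr
        nlinarith [mul_nonneg (norm_nonneg c) hK]

theorem id_mul (hF : Tame F) : Tame fun z => z * F z := by
  obtain ⟨hd, K, ρ, hK, h0, hρ, hb⟩ := hF
  refine ⟨differentiable_id.mul hd, K + 1, ρ, by positivity, h0, hρ, fun z => ?_⟩
  rw [norm_mul]
  exact (mul_le_mul_of_nonneg_left (hb z) (norm_nonneg z)).trans (norm_mul_majorant hK z)

/-- Cauchy's estimate on the unit circle about `z`: replacing `|z|` by `|z| + 1` changes the
exponent only by linear and constant terms, so `ρ` is preserved. -/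
theorem deriv (hF : Tame F) : Tame (deriv F) := by
  obtain ⟨hd, K, ρ, hK, h0, hρ, hb⟩ := hF
  refine ⟨hd.deriv, K * Real.exp (K + ρ / 2) + (K + ρ), ρ, by positivity, h0, hρ, fun z => ?_⟩
  have h := Complex.norm_deriv_le_of_forall_mem_sphere_norm_le (c := z) (R := 1) (f := F)
    (C := K * Real.exp (K * (‖z‖ + 1) + ρ * (‖z‖ + 1) ^ 2 / 2)) one_pos hd.diffContOnCl ?_
  · rw [div_one] at h
    refine h.trans ?_
    have e : Real.exp (K * (‖z‖ + 1) + ρ * (‖z‖ + 1) ^ 2 / 2) =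
        Real.exp (K + ρ / 2) * Real.exp ((K + ρ) * ‖z‖ + ρ * ‖z‖ ^ 2 / 2) := by
      rw [← Real.exp_add]; ring_nf
    rw [e, ← mul_assoc]
    unfold majorant
    have hp : K ≤ K * Real.exp (K + ρ / 2) :=
      le_mul_of_one_le_right hK (Real.one_le_exp (by positivity))
    gcongr
    · linarith
    · linarith
  · intro u hu
    have hu' : ‖u‖ ≤ ‖z‖ + 1 := by
      have h1 : ‖u - z‖ = 1 := by simpa [dist_eq_norm] using hu
      calc ‖u‖ = ‖z + (u - z)‖ := by ring_nf
        _ ≤ ‖z‖ + ‖u - z‖ := norm_add_le _ _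
        _ = _ := by rw [h1]
    refine (hb u).trans ?_
    unfold majorant
    gcongr

theorem exp_quadratic {a b c : ℂ} (hc : ‖c‖ < 1) : Tame fun z => cexp (a + b * z + c * z ^ 2 / 2) := by
  refine ⟨by fun_prop, Real.exp ‖a‖ + ‖b‖, ‖c‖, by positivity, norm_nonneg c, hc, fun z => ?_⟩
  rw [Complex.norm_exp]
  unfold majorant
  have h1 : (a + b * z + c * z ^ 2 / 2).re ≤ ‖a‖ + ‖b‖ * ‖z‖ + ‖c‖ * ‖z‖ ^ 2 / 2 := by
    refine (Complex.re_le_norm _).trans ((norm_add₃_le).trans ?_)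
    simp [norm_pow]
  calc Real.exp _ ≤ Real.exp (‖a‖ + ‖b‖ * ‖z‖ + ‖c‖ * ‖z‖ ^ 2 / 2) := Real.exp_le_exp.2 h1
    _ = Real.exp ‖a‖ * Real.exp (‖b‖ * ‖z‖ + ‖c‖ * ‖z‖ ^ 2 / 2) := by
        rw [← Real.exp_add]; ring_nf
    _ ≤ _ := by
        gcongr
        · linarith [norm_nonneg b]
        · linarith [Real.exp_pos ‖a‖]

theorem const (c : ℂ) : Tame fun _ => c := by
  have h := (exp_quadratic (a := 0) (b := 0) (c := 0) (by simp)).const_mul c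
  simpa using h

theorem poly (p : Polynomial ℂ) : Tame fun z => p.eval z := by
  induction p using Polynomial.induction_on' with
  | add p q hp hq => simpa using hp.add hq
  | monomial n c =>
    have : Tame fun z : ℂ => z ^ n := by
      induction n with
      | zero => simpa using const 1
      | succ n ih => simpa [pow_succ'] using ih.id_mul
    simpa using this.const_mul c

end Tame

/-! ### Taylor coefficients as inner products with monomials. -/

instance : SFinite bargmannMeasure := by unfold bargmannMeasure; infer_instance

theorem measurePreserving_rotation_bargmannMeasure (a : Circle) :
    MeasurePreserving (fun z : ℂ => (a : ℂ) * z) bargmannMeasure bargmannMeasure := by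
  have h : MeasurePreserving (fun z : ℂ => (a : ℂ) * z) volume volume :=
    (rotation a).measurePreserving
  refine ⟨h.measurable, ?_⟩
  ext s hs
  rw [Measure.map_apply h.measurable hs, bargmannMeasure, withDensity_apply _ hs,
    withDensity_apply _ (h.measurable hs), ← h.setLIntegral_comp_preimage hs (by fun_prop)]
  refine setLIntegral_congr_fun (h.measurable hs) fun z _ => ?_
  simp only [norm_mul, Circle.norm_coe, one_mul]

theorem integral_bargmannMeasure {E : Type*} [NormedAddCommGroup E] [NormedSpace ℝ E]
    (g : ℂ → E) :
    ∫ z, g z ∂bargmannMeasure = ∫ z : ℂ, (Real.pi⁻¹ * Real.exp (-‖z‖ ^ 2)) • g z := by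
  have hdens : Measurable fun z : ℂ => ENNReal.ofReal (Real.pi⁻¹ * Real.exp (-‖z‖ ^ 2)) := by
    fun_prop
  rw [bargmannMeasure, integral_withDensity_eq_integral_toReal_smul hdens
    (Eventually.of_forall fun z => ENNReal.ofReal_lt_top)]
  refine integral_congr_ae (Eventually.of_forall fun z => ?_)
  simp only
  rw [ENNReal.toReal_ofReal (by positivity)]

theorem integral_norm_pow_bargmannMeasure (n : ℕ) :
    ∫ z, (‖z‖ ^ n) ^ 2 ∂bargmannMeasure = n.factorial := by
  have h := Complex.integral_rpow_mul_exp_neg_rpow (p := 2) (q := 2 * n) (by norm_num)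
    (by have : (0 : ℝ) ≤ n := n.cast_nonneg
        linarith)
  have h2 : ((2 * n + 2 : ℝ) / 2) = n + 1 := by ring
  rw [h2, Real.Gamma_nat_eq_factorial] at h
  rw [integral_bargmannMeasure]
  have h3 : ∀ z : ℂ, (Real.pi⁻¹ * Real.exp (-‖z‖ ^ 2)) • (‖z‖ ^ n) ^ 2 =
      Real.pi⁻¹ * (‖z‖ ^ (2 * n : ℝ) * Real.exp (-‖z‖ ^ (2 : ℝ))) := by
    intro z
    have : ‖z‖ ^ (2 * n : ℝ) = (‖z‖ ^ n) ^ 2 := by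
      rw [← pow_mul, mul_comm n 2, ← Real.rpow_natCast]
      push_cast
      rfl
    rw [this, Real.rpow_two, smul_eq_mul]
    ring
  simp_rw [h3]
  rw [integral_const_mul, h]
  have := Real.pi_pos.ne'
  field_simp

/-- The Taylor coefficients at the origin. -/
def coeff (F : ℂ → ℂ) (n : ℕ) : ℂ := (n.factorial : ℂ)⁻¹ * iteratedDeriv n F 0

theorem hasSum_coeff {F : ℂ → ℂ} (hF : Differentiable ℂ F) (z : ℂ) :
    HasSum (fun n => coeff F n * z ^ n) (F z) := by
  have h := Complex.hasSum_taylorSeries_of_entire hF 0 z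
  refine h.congr_fun fun n => ?_
  simp only [coeff, sub_zero, smul_eq_mul]
  ring

theorem coeff_deriv (F : ℂ → ℂ) (n : ℕ) : coeff (deriv F) n = (n + 1) * coeff F (n + 1) := by
  have h : (n.factorial : ℂ) ≠ 0 := by exact_mod_cast n.factorial_ne_zero
  have h' : (n : ℂ) + 1 ≠ 0 := by exact_mod_cast n.succ_ne_zero
  rw [coeff, coeff, ← iteratedDeriv_succ', Nat.factorial_succ]
  push_cast
  field_simp

theorem coeff_add {F G : ℂ → ℂ} (hF : Differentiable ℂ F) (hG : Differentiable ℂ G) (n : ℕ) :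
    coeff (fun z => F z + G z) n = coeff F n + coeff G n := by
  rw [coeff, iteratedDeriv_fun_add hF.contDiff.contDiffAt hG.contDiff.contDiffAt, coeff, coeff]
  ring

theorem coeff_const_mul (F : ℂ → ℂ) (c : ℂ) (n : ℕ) :
    coeff (fun z => c * F z) n = c * coeff F n := by
  rw [coeff, iteratedDeriv_const_mul_field, coeff]
  ring

theorem iteratedDeriv_succ_id_mul {F : ℂ → ℂ} (hF : Differentiable ℂ F) (n : ℕ) :
    iteratedDeriv (n + 1) (fun z => z * F z) =
      fun z => z * iteratedDeriv (n + 1) F z + (n + 1) * iteratedDeriv n F z := by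
  have hd : ∀ k, Differentiable ℂ (iteratedDeriv k F) := fun k =>
    (hF.contDiff (n := ⊤)).differentiable_iteratedDeriv k (by exact WithTop.coe_lt_top _)
  induction n with
  | zero =>
    funext z
    rw [zero_add, iteratedDeriv_one, iteratedDeriv_one, iteratedDeriv_zero,
      ((hasDerivAt_id' z).fun_mul (hF z).hasDerivAt).deriv]
    push_cast
    ring
  | succ n ih =>
    rw [iteratedDeriv_succ, ih]
    funext z
    rw [(((hasDerivAt_id' z).fun_mul (hd (n + 1) z).hasDerivAt).fun_add
      ((hd n z).hasDerivAt.const_mul ((n : ℂ) + 1))).deriv, ← iteratedDeriv_succ,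
      ← iteratedDeriv_succ]
    push_cast
    ring

theorem coeff_id_mul_zero (F : ℂ → ℂ) : coeff (fun z => z * F z) 0 = 0 := by
  simp [coeff]

theorem coeff_id_mul_succ {F : ℂ → ℂ} (hF : Differentiable ℂ F) (n : ℕ) :
    coeff (fun z => z * F z) (n + 1) = coeff F n := by
  have h : (n.factorial : ℂ) ≠ 0 := by exact_mod_cast n.factorial_ne_zero
  have h' : (n : ℂ) + 1 ≠ 0 := by exact_mod_cast n.succ_ne_zero
  rw [coeff, coeff, iteratedDeriv_succ_id_mul hF, Nat.factorial_succ]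
  push_cast
  field_simp
  simp

theorem integral_exp_int_mul (k : ℤ) :
    ∫ θ in (0 : ℝ)..2 * Real.pi, cexp (k * θ * I) = if k = 0 then 2 * Real.pi else 0 := by
  split_ifs with h
  · simp [h]
  · have h1 : (k : ℂ) * I ≠ 0 := by simp [h]
    have h2 := integral_exp_mul_complex (a := 0) (b := 2 * Real.pi) h1
    have h3 : ∀ θ : ℝ, cexp (k * θ * I) = cexp (k * I * θ) := fun θ => by ring_nf
    simp_rw [h3]
    rw [h2]
    have h4 : cexp (k * I * ((2 * Real.pi : ℝ) : ℂ)) = 1 := by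
      rw [Complex.exp_eq_one_iff]
      exact ⟨k, by push_cast; ring⟩
    rw [h4]
    simp

/-- A Fourier coefficient of `θ ↦ F(e^{iθ}z)`, obtained by integrating the absolutely convergent
Taylor series term by term. -/
theorem integral_circle_eq_coeff {F : ℂ → ℂ} (hF : Differentiable ℂ F) (n : ℕ) (z : ℂ) :
    ∫ θ in (0 : ℝ)..2 * Real.pi, cexp (-(n * θ * I)) * F (cexp (θ * I) * z) =
      2 * Real.pi * (coeff F n * z ^ n) := by
  have h := intervalIntegral.hasSum_integral_of_dominated_convergence
    (μ := volume) (a := 0) (b := 2 * Real.pi)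
    (F := fun (k : ℕ) (θ : ℝ) => coeff F k * z ^ k * cexp (((k : ℤ) - n : ℤ) * θ * I))
    (f := fun θ : ℝ => cexp (-(n * θ * I)) * F (cexp (θ * I) * z))
    (fun k _ => ‖coeff F k * z ^ k‖) (fun k => Continuous.aestronglyMeasurable (by fun_prop))
    (fun k => Eventually.of_forall fun θ _ => ?_)
    (Eventually.of_forall fun θ _ => (hasSum_coeff hF z).summable.norm)
    (continuous_const.intervalIntegrable _ _)
    (Eventually.of_forall fun θ _ => ?_)
  · refine h.unique ?_
    have h1 : ∀ k : ℕ, ∫ θ in (0 : ℝ)..2 * Real.pi,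
        coeff F k * z ^ k * cexp (((k : ℤ) - n : ℤ) * θ * I) =
        if k = n then 2 * Real.pi * (coeff F n * z ^ n) else 0 := by
      intro k
      rw [intervalIntegral.integral_const_mul, integral_exp_int_mul]
      by_cases hk : k = n
      · simp [hk]; ring
      · have : ((k : ℤ) - n) ≠ 0 := by omega
        simp [hk, this]
    simp_rw [h1]
    exact hasSum_ite_eq n _
  · rw [norm_mul]
    have : ‖cexp (((k : ℤ) - n : ℤ) * θ * I)‖ = 1 := by
      have := Complex.norm_exp_ofReal_mul_I (((k : ℤ) - n : ℤ) * θ : ℝ)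
      push_cast at this ⊢
      exact this
    rw [this, mul_one]
  · have h2 := (hasSum_coeff hF (cexp (θ * I) * z)).mul_left (cexp (-(n * θ * I)))
    refine h2.congr_fun fun k => ?_
    rw [mul_pow, ← Complex.exp_nat_mul]
    have : cexp (((k : ℤ) - n : ℤ) * θ * I) = cexp (-(n * θ * I)) * cexp (k * (θ * I)) := by
      rw [← Complex.exp_add]
      push_cast
      ring_nf
    rw [this]
    ring

theorem Φ_apply (n : ℕ) (z : ℂ) : Φ n z = ((Real.sqrt n.factorial : ℝ) : ℂ)⁻¹ * z ^ n := rfl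

theorem sqrt_factorial_ne_zero (n : ℕ) : ((Real.sqrt n.factorial : ℝ) : ℂ) ≠ 0 := by
  have h : 0 < Real.sqrt n.factorial := Real.sqrt_pos.2 (by positivity)
  exact_mod_cast h.ne'

theorem sqrt_factorial_sq (n : ℕ) :
    ((Real.sqrt n.factorial : ℝ) : ℂ) * ((Real.sqrt n.factorial : ℝ) : ℂ) = n.factorial := by
  rw [← Complex.ofReal_mul, Real.mul_self_sqrt (by positivity)]
  simp

/-- Rotation invariance lets the integrand be averaged over the circle without changing the
integral. After Fubini, the inner integral isolates the `n`-th Taylor term, so the Taylor series is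
never exchanged with the Gaussian integral. -/
theorem integral_conj_pow_mul (f : Bargmann) (n : ℕ) :
    ∫ z, conj (z ^ n) * f z ∂bargmannMeasure = n.factorial * coeff f n := by
  have hint : Integrable (fun z => conj (z ^ n) * f z) bargmannMeasure := by
    have h1 : MemLp (fun z : ℂ => conj (z ^ n)) 2 bargmannMeasure := by
      refine (monomial_mem n).2.congr_norm
        (Continuous.aestronglyMeasurable (by fun_prop)) (Eventually.of_forall fun z => ?_)
      simp
    exact h1.integrable_mul f.memLp
  have hcont : Continuous fun z => f z := f.differentiable.continuous
  have hrot : ∀ θ : ℝ, ∀ z : ℂ, conj (z ^ n) * f (cexp (θ * I) * z) =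
      cexp (n * θ * I) * (conj ((cexp (θ * I) * z) ^ n) * f (cexp (θ * I) * z)) := by
    intro θ z
    have h1 : cexp (n * θ * I) * conj (cexp (θ * I) ^ n) = 1 := by
      rw [← Complex.exp_nat_mul, ← Complex.exp_conj, ← Complex.exp_add]
      simp [mul_assoc]
    rw [mul_pow, map_mul]
    linear_combination (-conj (z ^ n) * f (cexp (θ * I) * z)) * h1
  have hmp : ∀ θ : ℝ, MeasurePreserving (fun z : ℂ => cexp (θ * I) * z)
      bargmannMeasure bargmannMeasure := fun θ => by
    have := measurePreserving_rotation_bargmannMeasure (Circle.exp θ)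
    simpa using this
  have hemb : ∀ θ : ℝ, MeasurableEmbedding fun z : ℂ => cexp (θ * I) * z := fun θ =>
    (Homeomorph.mulLeft₀ (cexp (θ * I)) (Complex.exp_ne_zero _)).measurableEmbedding
  have hsec : ∀ θ : ℝ, Integrable (fun z => conj (z ^ n) * f (cexp (θ * I) * z))
      bargmannMeasure := fun θ => by
    simp_rw [hrot θ]
    exact (((hmp θ).integrable_comp_emb (hemb θ)).2 hint).const_mul _
  have hI : ∀ θ : ℝ, ∫ z, cexp (-(n * θ * I)) * (conj (z ^ n) * f (cexp (θ * I) * z))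
      ∂bargmannMeasure = ∫ z, conj (z ^ n) * f z ∂bargmannMeasure := by
    intro θ
    have h1 : ∀ z, cexp (-(n * θ * I)) * (conj (z ^ n) * f (cexp (θ * I) * z)) =
        conj ((cexp (θ * I) * z) ^ n) * f (cexp (θ * I) * z) := fun z => by
      rw [hrot θ, ← mul_assoc, ← Complex.exp_add]
      simp
    simp_rw [h1]
    exact (hmp θ).integral_comp (hemb θ) fun z => conj (z ^ n) * f z
  have hN : ∀ θ : ℝ, ∫ z, ‖cexp (-(n * θ * I)) * (conj (z ^ n) * f (cexp (θ * I) * z))‖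
      ∂bargmannMeasure = ∫ z, ‖conj (z ^ n) * f z‖ ∂bargmannMeasure := by
    intro θ
    rw [← (hmp θ).integral_comp (hemb θ) fun z => ‖conj (z ^ n) * f z‖]
    refine integral_congr_ae (Eventually.of_forall fun z => ?_)
    have h1 : ‖cexp (-(n * θ * I))‖ = 1 := by
      have := Complex.norm_exp_ofReal_mul_I (-(n * θ))
      push_cast at this
      rw [← this]
      ring_nf
    simp [h1, Complex.norm_exp_ofReal_mul_I]
  have hprod : Integrable (Function.uncurry fun (θ : ℝ) (z : ℂ) =>
      cexp (-(n * θ * I)) * (conj (z ^ n) * f (cexp (θ * I) * z)))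
      ((volume.restrict (Set.uIoc 0 (2 * Real.pi))).prod bargmannMeasure) := by
    have hc : Continuous (Function.uncurry fun (θ : ℝ) (z : ℂ) =>
        cexp (-(n * θ * I)) * (conj (z ^ n) * f (cexp (θ * I) * z))) := by
      have h1 : Continuous fun p : ℝ × ℂ => f (cexp (p.1 * I) * p.2) :=
        hcont.comp (by fun_prop)
      have h2 : Continuous fun p : ℝ × ℂ => cexp (-(n * p.1 * I)) := by fun_prop
      have h3 : Continuous fun p : ℝ × ℂ => conj (p.2 ^ n) := by fun_prop
      exact h2.mul (h3.mul h1)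
    rw [integrable_prod_iff hc.aestronglyMeasurable]
    have h4 : ∀ θ : ℝ, Integrable
        (fun z => cexp (-(n * θ * I)) * (conj (z ^ n) * f (cexp (θ * I) * z)))
        bargmannMeasure := fun θ => (hsec θ).const_mul (cexp (-(n * θ * I)))
    simp only [Function.uncurry_apply_pair, hN, Set.uIoc_of_le Real.two_pi_pos.le]
    exact ⟨Eventually.of_forall h4, integrable_const _⟩
  -- In one order the inner integral does not depend on `θ`; in the other it is a Fourier
  -- coefficient.
  have h1 := intervalIntegral_integral_swap hprod
  simp_rw [hI] at h1
  have h2 : ∀ z, ∫ θ in (0 : ℝ)..2 * Real.pi,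
      cexp (-(n * θ * I)) * (conj (z ^ n) * f (cexp (θ * I) * z)) =
      (2 * Real.pi * coeff f n) * (((‖z‖ ^ n) ^ 2 : ℝ) : ℂ) := by
    intro z
    have h3 : ∀ θ : ℝ, cexp (-(n * θ * I)) * (conj (z ^ n) * f (cexp (θ * I) * z)) =
        conj (z ^ n) * (cexp (-(n * θ * I)) * f (cexp (θ * I) * z)) := fun θ => by ring
    simp_rw [h3]
    rw [intervalIntegral.integral_const_mul, integral_circle_eq_coeff f.differentiable]
    have h4 := conj_mul' (z ^ n)
    rw [norm_pow] at h4
    push_cast at h4 ⊢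
    linear_combination (2 * Real.pi * coeff f n) * h4
  simp_rw [h2] at h1
  rw [integral_const_mul, integral_complex_ofReal, integral_norm_pow_bargmannMeasure,
    intervalIntegral.integral_const] at h1
  have hpi : (Real.pi : ℂ) ≠ 0 := by exact_mod_cast Real.pi_pos.ne'
  simp only [sub_zero, real_smul, ofReal_mul, ofReal_ofNat, ofReal_natCast] at h1
  have h5 : (2 * Real.pi : ℂ) ≠ 0 := mul_ne_zero two_ne_zero hpi
  refine mul_left_cancel₀ h5 (h1.trans ?_)
  ring

theorem inner_Φ (f : Bargmann) (n : ℕ) :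
    inner ℂ (Φ n) f = ((Real.sqrt n.factorial : ℝ) : ℂ) * coeff f n := by
  rw [Bargmann.inner_eq_integral]
  have h : ∀ z, conj (Φ n z) * f z =
      ((Real.sqrt n.factorial : ℝ) : ℂ)⁻¹ * (conj (z ^ n) * f z) := fun z => by
    rw [Φ_apply, map_mul, map_inv₀, Complex.conj_ofReal]
    ring
  simp_rw [h]
  rw [integral_const_mul, integral_conj_pow_mul, ← sqrt_factorial_sq]
  field_simp [sqrt_factorial_ne_zero n]

theorem coeff_Φ (m n : ℕ) :
    coeff (Φ n) m = if m = n then ((Real.sqrt n.factorial : ℝ) : ℂ)⁻¹ else 0 := by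
  have h : (Φ n).toFun = fun z => ((Real.sqrt n.factorial : ℝ) : ℂ)⁻¹ * z ^ n := rfl
  rw [h, coeff_const_mul]
  have h2 : coeff (fun z : ℂ => z ^ n) m = if m = n then 1 else 0 := by
    induction n generalizing m with
    | zero =>
      cases m with
      | zero => simp [coeff]
      | succ m => simp [coeff, iteratedDeriv_const]
    | succ n ih =>
      have h3 : (fun z : ℂ => z ^ (n + 1)) = fun z => z * z ^ n := by
        funext z; ring
      rw [h3]
      cases m with
      | zero => simpa using coeff_id_mul_zero _
      | succ m =>
        rw [coeff_id_mul_succ (differentiable_pow n), ih m rfl]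
        simp
  rw [h2]
  split_ifs <;> simp

theorem orthonormal_Φ : Orthonormal ℂ Φ := by
  classical
  rw [orthonormal_iff_ite]
  intro i j
  rw [inner_Φ, coeff_Φ]
  split_ifs with h
  · subst h
    exact mul_inv_cancel₀ (sqrt_factorial_ne_zero i)
  · simp

theorem norm_coeff_le (f : Bargmann) (n : ℕ) :
    ‖coeff f n‖ ≤ ‖f‖ * (Real.sqrt n.factorial)⁻¹ := by
  have h := norm_inner_le_norm (𝕜 := ℂ) (Φ n) f
  rw [inner_Φ, orthonormal_Φ.1 n, one_mul, norm_mul, Complex.norm_real,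
    Real.norm_of_nonneg (Real.sqrt_nonneg _)] at h
  have h0 : 0 < Real.sqrt n.factorial := Real.sqrt_pos.2 (by positivity)
  rw [← div_eq_mul_inv, le_div_iff₀ h0]
  linarith

/-! ### Bounded evaluation and completeness. -/

theorem summable_pow_div_sqrt_factorial (r : ℝ) :
    Summable fun n : ℕ => r ^ n * (Real.sqrt n.factorial)⁻¹ := by
  -- The term factors as `ab` with `a = (2|r|)ⁿ/√(n!)` and `b = 2⁻ⁿ`; then `ab ≤ a² + b²`, and both
  -- squares are summable.
  have h1 := (Real.summable_pow_div_factorial (4 * r ^ 2)).add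
    (summable_geometric_of_lt_one (r := (1 / 4 : ℝ)) (by norm_num) (by norm_num))
  refine Summable.of_norm_bounded h1 fun n => ?_
  have h0 : 0 < Real.sqrt n.factorial := Real.sqrt_pos.2 (by positivity)
  have h2 : (4 * r ^ 2) ^ n / n.factorial = ((2 * |r|) ^ n * (Real.sqrt n.factorial)⁻¹) ^ 2 := by
    rw [mul_pow _ (_⁻¹), inv_pow, Real.sq_sqrt (by positivity), ← pow_mul, mul_comm n 2, pow_mul,
      mul_pow 2 |r|, sq_abs, div_eq_mul_inv]
    norm_num
  have h3 : (1 / 4 : ℝ) ^ n = ((1 / 2) ^ n) ^ 2 := by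
    rw [← pow_mul, mul_comm n 2, pow_mul]
    norm_num
  have h4 : ‖r ^ n * (Real.sqrt n.factorial)⁻¹‖ =
      ((2 * |r|) ^ n * (Real.sqrt n.factorial)⁻¹) * (1 / 2) ^ n := by
    rw [norm_mul, norm_pow, Real.norm_eq_abs, Real.norm_of_nonneg (by positivity), mul_pow]
    have : (2 : ℝ) ^ n * (1 / 2) ^ n = 1 := by rw [← mul_pow]; norm_num
    linear_combination (-|r| ^ n * (Real.sqrt n.factorial)⁻¹) * this
  rw [h2, h3, h4]
  nlinarith [sq_nonneg ((2 * |r|) ^ n * (Real.sqrt n.factorial)⁻¹ - (1 / 2) ^ n),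
    sq_nonneg ((2 * |r|) ^ n * (Real.sqrt n.factorial)⁻¹ + (1 / 2) ^ n)]

/-- The norm of evaluation is locally bounded. -/
theorem norm_apply_le (f : Bargmann) {r : ℝ} {z : ℂ} (hz : ‖z‖ ≤ r) :
    ‖f z‖ ≤ ‖f‖ * ∑' n : ℕ, r ^ n * (Real.sqrt n.factorial)⁻¹ := by
  have h := hasSum_coeff f.differentiable z
  rw [← h.tsum_eq, ← tsum_mul_left]
  refine tsum_of_norm_bounded ((summable_pow_div_sqrt_factorial r).mul_left _).hasSum fun n => ?_
  rw [norm_mul, norm_pow]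
  have h1 := norm_coeff_le f n
  have h2 : ‖z‖ ^ n ≤ r ^ n := by gcongr
  calc ‖coeff f n‖ * ‖z‖ ^ n ≤ (‖f‖ * (Real.sqrt n.factorial)⁻¹) * r ^ n := by gcongr
    _ = _ := by ring

/-- Local boundedness of evaluation turns a Cauchy sequence into a locally uniformly convergent one
with entire limit. The `L²` limit agrees with it almost everywhere, along a subsequence converging
almost everywhere. -/
instance : CompleteSpace Bargmann := by
  refine Metric.complete_of_cauchySeq_tendsto fun u hu => ?_
  set C : ℝ → ℝ := fun r => ∑' n : ℕ, r ^ n * (Real.sqrt n.factorial)⁻¹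
  -- locally uniform convergence
  have hunif : ∀ r : ℝ, UniformCauchySeqOn (fun n z => u n z) atTop (Metric.closedBall 0 r) := by
    intro r
    rw [Metric.uniformCauchySeqOn_iff]
    intro ε hε
    obtain ⟨N, hN⟩ := Metric.cauchySeq_iff.1 hu (ε / (|C r| + 1)) (by positivity)
    refine ⟨N, fun m hm n hn z hz => ?_⟩
    have h1 := norm_apply_le (u m - u n) (by simpa using hz : ‖z‖ ≤ r)
    rw [Bargmann.sub_apply] at h1
    have h2 := hN m hm n hn
    rw [dist_eq_norm] at h2 ⊢
    calc ‖u m z - u n z‖ ≤ ‖u m - u n‖ * (|C r| + 1) :=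
          h1.trans (mul_le_mul_of_nonneg_left ((le_abs_self _).trans (by linarith))
            (norm_nonneg _))
      _ < ε := by
          rwa [lt_div_iff₀ (by positivity)] at h2
  have hpt : ∀ z : ℂ, ∃ l, Tendsto (fun n => u n z) atTop (𝓝 l) := fun z =>
    cauchySeq_tendsto_of_complete ((hunif ‖z‖).cauchySeq (by simp))
  choose F hF using hpt
  have hloc : TendstoLocallyUniformlyOn (fun n z => u n z) F atTop Set.univ := by
    rw [tendstoLocallyUniformlyOn_iff_forall_isCompact isOpen_univ]
    intro K _ hK
    obtain ⟨r, hr⟩ := hK.isBounded.subset_closedBall 0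
    exact ((hunif r).tendstoUniformlyOn_of_tendsto fun z _ => hF z).mono hr
  have hd : Differentiable ℂ F := differentiableOn_univ.1
    (hloc.differentiableOn (Eventually.of_forall fun n => (u n).differentiable.differentiableOn)
      isOpen_univ)
  have hcau : CauchySeq fun n => Bargmann.toLp (u n) := by
    rw [Metric.cauchySeq_iff] at hu ⊢
    intro ε hε
    obtain ⟨N, hN⟩ := hu ε hε
    refine ⟨N, fun m hm n hn => ?_⟩
    have := hN m hm n hn
    rw [dist_eq_norm] at this ⊢
    rw [← map_sub]
    exact this
  obtain ⟨G, hG⟩ := cauchySeq_tendsto_of_complete hcau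
  have hmeas := tendstoInMeasure_of_tendsto_Lp hG
  obtain ⟨φ, hφ, hae⟩ := hmeas.exists_seq_tendsto_ae
  have hGF : G =ᵐ[bargmannMeasure] F := by
    have h1 : ∀ᵐ z ∂bargmannMeasure, ∀ n, Bargmann.toLp (u n) z = u n z :=
      ae_all_iff.2 fun n => (u n).memLp.coeFn_toLp
    filter_upwards [hae, h1] with z hz hz1
    simp_rw [hz1] at hz
    exact tendsto_nhds_unique hz ((hF z).comp hφ.tendsto_atTop)
  have hmem : MemLp F 2 bargmannMeasure := (memLp_congr_ae hGF).1 (Lp.memLp G)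
  refine ⟨Bargmann.mk F ⟨hd, hmem⟩, ?_⟩
  have hG2 : G = Bargmann.toLp (Bargmann.mk F ⟨hd, hmem⟩) :=
    Lp.ext (hGF.trans (MemLp.coeFn_toLp hmem).symm)
  rw [hG2, tendsto_iff_norm_sub_tendsto_zero] at hG
  rw [tendsto_iff_norm_sub_tendsto_zero]
  refine hG.congr fun n => ?_
  rw [← map_sub]
  rfl

/-! ### The Fock basis, Taylor truncation and adjointness of `z` and `∂_z`. -/

theorem eq_zero_of_coeff_eq_zero {f : Bargmann} (h : ∀ n, coeff f n = 0) : f = 0 := by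
  refine Bargmann.ext fun z => ?_
  have h1 := hasSum_coeff f.differentiable z
  simp only [h, zero_mul] at h1
  exact h1.unique hasSum_zero

/-- The vectors `Φ n` as a Hilbert basis. -/
def fockBasis : HilbertBasis ℕ ℂ Bargmann :=
  HilbertBasis.mkOfOrthogonalEqBot orthonormal_Φ (by
    rw [Submodule.eq_bot_iff]
    intro f hf
    refine eq_zero_of_coeff_eq_zero fun n => ?_
    have h := (Submodule.mem_orthogonal _ _).1 hf (Φ n) (Submodule.subset_span ⟨n, rfl⟩)
    rw [inner_Φ] at h
    exact (mul_eq_zero.1 h).resolve_left (sqrt_factorial_ne_zero n))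

theorem fockBasis_apply (n : ℕ) : fockBasis n = Φ n :=
  congrFun (HilbertBasis.coe_mkOfOrthogonalEqBot _ _) n

theorem hasSum_inner (f g : Bargmann) :
    HasSum (fun n : ℕ => (n.factorial : ℂ) * (conj (coeff f n) * coeff g n)) (inner ℂ f g) := by
  refine (fockBasis.hasSum_inner_mul_inner f g).congr_fun fun n => ?_
  rw [fockBasis_apply, ← inner_conj_symm f, inner_Φ, inner_Φ, map_mul, Complex.conj_ofReal,
    ← sqrt_factorial_sq]
  ring

/-- The Taylor polynomials at the origin. -/
def taylorPoly (N : ℕ) (F : ℂ → ℂ) : Polynomial ℂ :=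
  ∑ n ∈ Finset.range N, Polynomial.monomial n (coeff F n)

theorem tendsto_taylorPoly (f : Bargmann) :
    Tendsto (fun N => ofPoly (taylorPoly N f)) atTop (𝓝 f) := by
  refine (fockBasis.hasSum_repr f).tendsto_sum_nat.congr fun N => ?_
  refine Bargmann.ext fun z => ?_
  rw [Bargmann.sum_apply]
  simp only [ofPoly, Bargmann.mk_apply, taylorPoly, Polynomial.eval_finsetSum,
    Polynomial.eval_monomial]
  refine Finset.sum_congr rfl fun n _ => ?_
  rw [HilbertBasis.repr_apply_apply, fockBasis_apply, inner_Φ, Bargmann.smul_apply, Φ_apply]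
  have := sqrt_factorial_ne_zero n
  field_simp

theorem X_mul_taylorPoly {F : ℂ → ℂ} (hF : Differentiable ℂ F) (N : ℕ) :
    Polynomial.X * taylorPoly N F = taylorPoly (N + 1) fun z => z * F z := by
  rw [taylorPoly, taylorPoly, Finset.sum_range_succ', Finset.mul_sum, coeff_id_mul_zero]
  simp [coeff_id_mul_succ hF, Polynomial.X_mul_monomial]

theorem derivative_taylorPoly (F : ℂ → ℂ) (N : ℕ) :
    Polynomial.derivative (taylorPoly (N + 1) F) = taylorPoly N (deriv F) := by
  rw [taylorPoly, taylorPoly, Finset.sum_range_succ', Polynomial.derivative_add,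
    Polynomial.derivative_sum]
  simp [coeff_deriv, mul_comm]

/-- The adjoint relations between `z` and `∂_z`. -/
theorem inner_eq_of_eq_deriv_add_mul {q f g r d : Bargmann} {α β : ℂ}
    (hr : ∀ z, r z = z * q z) (hd : ∀ z, d z = deriv q z)
    (hg : ∀ z, g z = α * deriv f z + β * (z * f z)) :
    inner ℂ q g = α * inner ℂ r f + β * inner ℂ d f := by
  have hr' : r.toFun = fun z => z * q z := funext hr
  have hd' : d.toFun = deriv q := funext hd
  have hg' : g.toFun = fun z => α * deriv f z + β * (z * f z) := funext hg
  -- The comparison is made coefficientwise, since `f'` and `zf` need not lie separately in the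
  -- space.
  have hcg : ∀ n, coeff g n = α * coeff (deriv f) n + β * coeff (fun z => z * f z) n := by
    intro n
    rw [hg', coeff_add (f.differentiable.deriv.const_mul α)
      (((differentiable_fun_id (𝕜 := ℂ)).fun_mul f.differentiable).const_mul β), coeff_const_mul, coeff_const_mul]
  have h1 : HasSum (fun n : ℕ => (n.factorial : ℂ) * (conj (coeff q n) * coeff (deriv f) n))
      (inner ℂ r f) := by
    -- The constant coefficient of `zq` vanishes, so the sum may be shifted by one; `(n+1)! = (n+1)
    -- n!` then produces the coefficients of `f'`.
    have h := (hasSum_nat_add_iff' 1).2 (hasSum_inner r f)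
    simp only [hr', Finset.sum_range_one, coeff_id_mul_zero, map_zero, zero_mul, mul_zero,
      sub_zero, coeff_id_mul_succ q.differentiable] at h
    refine h.congr_fun fun n => ?_
    rw [coeff_deriv, Nat.factorial_succ]
    push_cast
    ring
  have h2 : HasSum (fun n : ℕ => (n.factorial : ℂ) * (conj (coeff q n) *
      coeff (fun z => z * f z) n)) (inner ℂ d f) := by
    have h := hasSum_inner d f
    rw [← hasSum_nat_add_iff' 1]
    simp only [Finset.sum_range_one, coeff_id_mul_zero, mul_zero, sub_zero,
      coeff_id_mul_succ f.differentiable]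
    refine h.congr_fun fun n => ?_
    rw [hd', coeff_deriv, Nat.factorial_succ]
    simp only [map_mul, map_add, map_natCast, map_one]
    push_cast
    ring
  refine (hasSum_inner q g).unique (((h1.mul_left α).add (h2.mul_left β)).congr_fun fun n => ?_)
  rw [hcg]
  ring

/-! ### Coherent states as reproducing kernels. -/

/-- A tame function as an element of the Bargmann space. -/
def ofTame (F : ℂ → ℂ) (hF : Tame F) : Bargmann := Bargmann.mk F hF.mem

@[simp] theorem ofTame_apply (F : ℂ → ℂ) (hF : Tame F) (z : ℂ) : ofTame F hF z = F z := rfl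

theorem tame_exp_mul (w : ℂ) : Tame fun z => cexp (w * z) := by
  simpa using Tame.exp_quadratic (a := 0) (b := w) (c := 0) (by simp)

/-- The coherent state `z ↦ e^{w z}`. -/
def coherent (w : ℂ) : Bargmann := ofTame _ (tame_exp_mul w)

theorem coherent_apply (w z : ℂ) : coherent w z = cexp (w * z) := rfl

theorem coeff_exp_mul (w : ℂ) (n : ℕ) :
    coeff (fun z => cexp (w * z)) n = (n.factorial : ℂ)⁻¹ * w ^ n := by
  rw [coeff]
  have := congrFun (iteratedDeriv_cexp_const_mul n w) 0
  rw [this]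
  simp

theorem inner_coherent (w : ℂ) (f : Bargmann) : inner ℂ (coherent (conj w)) f = f w := by
  refine (hasSum_inner _ f).unique ((hasSum_coeff f.differentiable w).congr_fun fun n => ?_)
  have h : (coherent (conj w)).toFun = fun z => cexp (conj w * z) := rfl
  have h0 : (n.factorial : ℂ) ≠ 0 := by exact_mod_cast n.factorial_ne_zero
  rw [h, coeff_exp_mul]
  simp only [map_mul, map_inv₀, map_natCast, map_pow, conj_conj]
  field_simp

/-- The derivative `z ↦ z e^{w z}` of the coherent states in the parameter. -/
def coherentDeriv (w : ℂ) : Bargmann := ofTame _ (tame_exp_mul w).id_mul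

theorem inner_coherentDeriv (w : ℂ) (f : Bargmann) :
    inner ℂ (coherentDeriv (conj w)) f = deriv f w := by
  refine (hasSum_inner _ f).unique ?_
  have h : (coherentDeriv (conj w)).toFun = fun z => z * cexp (conj w * z) := rfl
  rw [← hasSum_nat_add_iff' 1]
  simp only [h, Finset.sum_range_one, coeff_id_mul_zero, map_zero, zero_mul, mul_zero, sub_zero,
    coeff_id_mul_succ (tame_exp_mul (conj w)).1]
  refine (hasSum_coeff f.differentiable.deriv w).congr_fun fun n => ?_
  have h0 : (n.factorial : ℂ) ≠ 0 := by exact_mod_cast n.factorial_ne_zero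
  rw [coeff_exp_mul, coeff_deriv, Nat.factorial_succ]
  simp only [map_mul, map_inv₀, map_natCast, map_pow, conj_conj]
  push_cast
  field_simp

theorem eq_of_forall_inner_coherent {f g : Bargmann}
    (h : ∀ w, inner ℂ (coherent w) f = inner ℂ (coherent w) g) : f = g := by
  refine Bargmann.ext fun w => ?_
  rw [← inner_coherent, h, inner_coherent]

/-! ### The ladder operators -/

theorem continuous_apply (w : ℂ) : Continuous fun f : Bargmann => f w := by
  simp_rw [← inner_coherent]
  fun_prop

theorem continuous_deriv_apply (w : ℂ) : Continuous fun f : Bargmann => deriv f w := by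
  simp_rw [← inner_coherentDeriv]
  fun_prop

theorem ofPoly_apply (p : Polynomial ℂ) (z : ℂ) : ofPoly p z = p.eval z := rfl

theorem ofPoly_add (p q : Polynomial ℂ) : ofPoly (p + q) = ofPoly p + ofPoly q :=
  Bargmann.ext fun z => by simp [ofPoly_apply]

theorem ofPoly_monomial (n : ℕ) (c : ℂ) :
    ofPoly (Polynomial.monomial n c) = (c * ((Real.sqrt n.factorial : ℝ) : ℂ)) • Φ n :=
  Bargmann.ext fun z => by
    have := sqrt_factorial_ne_zero n
    rw [ofPoly_apply, Polynomial.eval_monomial, Bargmann.smul_apply, Φ_apply]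
    field_simp

theorem sqrt_factorial_succ (n : ℕ) : ((Real.sqrt (n + 1).factorial : ℝ) : ℂ) =
    ((Real.sqrt (n + 1) : ℝ) : ℂ) * ((Real.sqrt n.factorial : ℝ) : ℂ) := by
  rw [Nat.factorial_succ, Nat.cast_mul, Real.sqrt_mul (by positivity)]
  push_cast
  rfl

theorem sqrt_succ_mul_self (n : ℕ) :
    ((Real.sqrt (n + 1) : ℝ) : ℂ) * ((Real.sqrt (n + 1) : ℝ) : ℂ) = n + 1 := by
  rw [← Complex.ofReal_mul, Real.mul_self_sqrt (by positivity)]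
  push_cast
  rfl

theorem sqrt_succ_ne_zero (n : ℕ) : ((Real.sqrt (n + 1) : ℝ) : ℂ) ≠ 0 := by
  have h : 0 < Real.sqrt (n + 1 : ℝ) := Real.sqrt_pos.2 (by positivity)
  exact_mod_cast h.ne'

theorem id_mul_Φ (n : ℕ) (z : ℂ) :
    (((Real.sqrt (n + 1) : ℝ) : ℂ) • Φ (n + 1)) z = z * Φ n z := by
  have := sqrt_factorial_ne_zero n
  have := sqrt_succ_ne_zero n
  rw [Bargmann.smul_apply, Φ_apply, Φ_apply, sqrt_factorial_succ]
  field_simp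
  ring

theorem deriv_Φ (n : ℕ) (z : ℂ) :
    (((Real.sqrt n : ℝ) : ℂ) • Φ (n - 1)) z = deriv (Φ n) z := by
  have h : deriv (Φ n) z = ((Real.sqrt n.factorial : ℝ) : ℂ)⁻¹ * (n * z ^ (n - 1)) :=
    ((hasDerivAt_pow n z).const_mul _).deriv
  rw [h]
  cases n with
  -- Here `Φ (n - 1)` is `Φ 0` by truncated subtraction, and the factor `√0` removes it.
  | zero => simp [Bargmann.zero_apply]
  | succ n =>
    have := sqrt_factorial_ne_zero n
    have := sqrt_succ_ne_zero n
    have h2 := sqrt_succ_mul_self n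
    rw [Bargmann.smul_apply, Nat.add_sub_cancel, Φ_apply, sqrt_factorial_succ]
    push_cast
    rw [← h2]
    field_simp

/-- The pointwise relation `g w = T w f` is closed, so it survives the closure of the span;
conversely `happ` supplies polynomial pairs converging to any pair that satisfies it. Thus the
closure already has the maximal domain. -/
theorem graph_toLinearPMap_closure (T : ℂ → Bargmann → ℂ) (hT : ∀ w, Continuous (T w))
    (hadd : ∀ w f g, T w (f + g) = T w f + T w g) (hsmul : ∀ w c f, T w (c • f) = c * T w f)
    (v : ℕ → Bargmann) (hv : ∀ n w, v n w = T w (Φ n))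
    (happ : ∀ f g : Bargmann, (∀ w, g w = T w f) → ∃ p q : ℕ → Polynomial ℂ,
      Tendsto (fun N => ofPoly (p N)) atTop (𝓝 f) ∧ Tendsto (fun N => ofPoly (q N)) atTop (𝓝 g) ∧
      ∀ N w, ofPoly (q N) w = T w (ofPoly (p N)))
    (f g : Bargmann) :
    (f, g) ∈ (Submodule.span ℂ (Set.range fun n : ℕ =>
      ((Φ n, v n) : Bargmann × Bargmann))).topologicalClosure.toLinearPMap.graph ↔
      ∀ w, g w = T w f := by
  have hT0 : ∀ w, T w 0 = 0 := fun w => by simpa using hsmul w 0 0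
  set V := Submodule.span ℂ (Set.range fun n : ℕ => ((Φ n, v n) : Bargmann × Bargmann)) with hV
  have hclosed : IsClosed {x : Bargmann × Bargmann | ∀ w, x.2 w = T w x.1} := by
    simp only [Set.ofPred_forall]
    exact isClosed_iInter fun w =>
      isClosed_eq ((continuous_apply w).comp continuous_snd) ((hT w).comp continuous_fst)
  have hsub : ∀ x ∈ V, ∀ w, x.2 w = T w x.1 := by
    intro x hx
    induction hx using Submodule.span_induction with
    | mem x hx =>
      obtain ⟨n, rfl⟩ := hx
      exact hv n
    | zero => intro w; simp [hT0, Bargmann.zero_apply]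
    | add x y _ _ hx hy => intro w; simp [hx w, hy w, hadd]
    | smul c x _ hx => intro w; simp [hx w, hsmul]
  have hcl : ∀ x ∈ V.topologicalClosure, ∀ w, x.2 w = T w x.1 := fun x hx =>
    closure_minimal (t := {x : Bargmann × Bargmann | ∀ w, x.2 w = T w x.1}) hsub hclosed hx
  -- The closed subspace is a graph because its pointwise relation forces the second entry to vanish
  -- with the first.
  rw [Submodule.toLinearPMap_graph_eq _ (fun x hx h0 => Bargmann.ext fun w => by
    rw [hcl x hx w, h0, hT0, Bargmann.zero_apply])]
  refine ⟨hcl _, fun h => ?_⟩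
  have hpoly : ∀ p : Polynomial ℂ, ∃ g : Bargmann, (ofPoly p, g) ∈ V := by
    intro p
    induction p using Polynomial.induction_on' with
    | add p q hp hq =>
      obtain ⟨a, ha⟩ := hp
      obtain ⟨b, hb⟩ := hq
      refine ⟨a + b, ?_⟩
      rw [ofPoly_add]
      exact V.add_mem ha hb
    | monomial n c =>
      refine ⟨(c * ((Real.sqrt n.factorial : ℝ) : ℂ)) • v n, ?_⟩
      rw [ofPoly_monomial]
      exact V.smul_mem _ (Submodule.subset_span ⟨n, rfl⟩)
  obtain ⟨p, q, hp, hq, hpq⟩ := happ f g h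
  refine mem_closure_of_tendsto (hp.prodMk_nhds hq) (Eventually.of_forall fun N => ?_)
  obtain ⟨g', hg'⟩ := hpoly (p N)
  have : g' = ofPoly (q N) := Bargmann.ext fun w => by rw [hpq, ← hsub _ hg' w]
  rwa [this] at hg'

/-- Differentiating a Taylor truncation of `f` gives a truncation of `f'` one degree shorter; both
converge in norm as soon as `f'` lies in the space. -/
theorem mem_graph_lowering {f g : Bargmann} :
    (f, g) ∈ lowering.graph ↔ ∀ w, g w = deriv f w := by
  refine graph_toLinearPMap_closure (fun w f => deriv f w) continuous_deriv_apply
    (fun w f g => ?_) (fun w c f => ?_) _ (fun n w => deriv_Φ n w) (fun f g h => ?_) f g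
  · rw [Bargmann.coe_add, deriv_add (f.differentiable w) (g.differentiable w)]
  · rw [Bargmann.coe_smul, deriv_const_smul c (f.differentiable w), smul_eq_mul]
  · have hg : g.toFun = deriv f := funext h
    refine ⟨fun N => taylorPoly (N + 1) f, fun N => taylorPoly N g,
      (tendsto_taylorPoly f).comp (tendsto_add_atTop_nat 1), tendsto_taylorPoly g, fun N w => ?_⟩
    simp only [hg, ← derivative_taylorPoly]
    exact (Polynomial.deriv _).symm

theorem mem_graph_raising {f g : Bargmann} :
    (f, g) ∈ raising.graph ↔ ∀ w, g w = w * f w := by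
  refine graph_toLinearPMap_closure (fun w f => w * f w)
    (fun w => (continuous_apply w).const_mul w)
    (fun w f g => ?_) (fun w c f => ?_) _ (fun n w => id_mul_Φ n w) (fun f g h => ?_) f g
  · rw [Bargmann.add_apply]; ring
  · rw [Bargmann.smul_apply]; ring
  · have hg : g.toFun = fun z => z * f z := funext h
    refine ⟨fun N => taylorPoly N f, fun N => taylorPoly (N + 1) g,
      tendsto_taylorPoly f, (tendsto_taylorPoly g).comp (tendsto_add_atTop_nat 1), fun N w => ?_⟩
    simp [hg, ← X_mul_taylorPoly f.differentiable, ofPoly_apply]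

theorem mem_graph_diffOp {α β : ℂ} {f g : Bargmann} :
    (f, g) ∈ (diffOp α β).graph ↔ ∀ w, g w = α * deriv f w + β * w * f w := by
  rw [LinearPMap.mem_graph_iff]
  constructor
  · rintro ⟨y, rfl, rfl⟩ w
    rfl
  · intro h
    have hg : g.toFun = diffExpr α β f := funext h
    refine ⟨⟨f, ?_⟩, rfl, ?_⟩
    · change diffExpr α β f ∈ bargmannSubmodule
      rw [← hg]
      exact Subtype.property g
    · exact Bargmann.ext fun w => (h w).symm

theorem mem_graph_squeeze {ξ : ℂ} {T : Bargmann →ₗ.[ℂ] Bargmann}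
    (hS : ∀ f, S ξ (S (-ξ) f) = f) (hS' : ∀ f, S (-ξ) (S ξ f) = f) {f g : Bargmann} :
    (f, g) ∈ (squeeze ξ T).graph ↔ (S (-ξ) f, S (-ξ) g) ∈ T.graph := by
  rw [LinearPMap.mem_graph_iff, LinearPMap.mem_graph_iff]
  constructor
  · rintro ⟨y, rfl, rfl⟩
    exact ⟨⟨S (-ξ) y, y.2⟩, rfl, (hS' _).symm⟩
  · rintro ⟨y, hy, hy'⟩
    simp only at hy hy'
    have hm : f ∈ (squeeze ξ T).domain := by
      change S (-ξ) f ∈ T.domain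
      rw [← hy]
      exact y.2
    refine ⟨⟨f, hm⟩, rfl, ?_⟩
    have : y = ⟨S (-ξ) f, hm⟩ := Subtype.ext hy
    change S ξ (T ⟨S (-ξ) f, hm⟩) = g
    rw [← this, hy', hS]

/-! ### Unitary groups from families with shift-invariant Gram matrix. -/

section UnitaryGroup

variable {H : Type*} [NormedAddCommGroup H] [InnerProductSpace ℂ H] [CompleteSpace H] {ι : Type*}

/-- The Gram matrix determines the norm of every finite linear combination, so `a i ↦ b i` is well
defined and isometric on a dense subspace. -/
theorem exists_linearIsometry_of_inner_eq {a b : ι → H}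
    (hab : ∀ i j, inner ℂ (b i) (b j) = inner ℂ (a i) (a j))
    (ha : Dense (Submodule.span ℂ (Set.range a) : Set H)) :
    ∃ V : H →ₗᵢ[ℂ] H, ∀ i, V (a i) = b i := by
  classical
  have hnorm : ∀ x : ι →₀ ℂ, ‖Finsupp.linearCombination ℂ b x‖ =
      ‖Finsupp.linearCombination ℂ a x‖ := by
    intro x
    have h : ∀ c : ι → H, ((‖Finsupp.linearCombination ℂ c x‖ ^ 2 : ℝ) : ℂ) =
        ∑ i ∈ x.support, ∑ j ∈ x.support, conj (x j) * (x i * inner ℂ (c j) (c i)) := by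
      intro c
      push_cast
      rw [← Complex.coe_algebraMap, ← inner_self_eq_norm_sq_to_K (𝕜 := ℂ),
        Finsupp.linearCombination_apply, Finsupp.sum, inner_sum]
      refine Finset.sum_congr rfl fun i _ => ?_
      rw [sum_inner]
      refine Finset.sum_congr rfl fun j _ => ?_
      rw [inner_smul_left, inner_smul_right]
    have h2 : ((‖Finsupp.linearCombination ℂ b x‖ ^ 2 : ℝ) : ℂ) =
        ((‖Finsupp.linearCombination ℂ a x‖ ^ 2 : ℝ) : ℂ) := by
      rw [h, h]
      simp_rw [hab]
    have h3 : ‖Finsupp.linearCombination ℂ b x‖ ^ 2 = ‖Finsupp.linearCombination ℂ a x‖ ^ 2 := by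
      exact_mod_cast h2
    exact (sq_eq_sq₀ (norm_nonneg _) (norm_nonneg _)).1 h3
  have hdense : DenseRange (Finsupp.linearCombination ℂ a) := by
    rw [DenseRange, ← LinearMap.coe_range, Finsupp.range_linearCombination]
    exact ha
  set W := (Finsupp.linearCombination ℂ b).extendOfNorm (Finsupp.linearCombination ℂ a)
  have hW : ∀ x, W (Finsupp.linearCombination ℂ a x) = Finsupp.linearCombination ℂ b x :=
    LinearMap.extendOfNorm_eq hdense ⟨1, fun x => by rw [hnorm, one_mul]⟩
  refine ⟨⟨W.toLinearMap, fun x => ?_⟩, fun i => ?_⟩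
  · refine hdense.induction_on (p := fun x => ‖W x‖ = ‖x‖) x
      (isClosed_eq (by fun_prop) (by fun_prop)) fun y => ?_
    rw [hW, hnorm]
  · have := hW (Finsupp.single i 1)
    simpa using this

theorem exists_unitary_group {u : ι → ℝ → H}
    (hu : ∀ i j r s t, inner ℂ (u i (s + r)) (u j (t + r)) = inner ℂ (u i s) (u j t))
    (hd : Dense (Submodule.span ℂ (Set.range fun i => u i 0) : Set H))
    (hc : ∀ i, Continuous (u i)) :
    ∃ U : ℝ → H ≃ₗᵢ[ℂ] H, U 0 = 1 ∧ (∀ s t, U (s + t) = U s * U t) ∧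
      (∀ f, Continuous fun t => U t f) ∧ ∀ i t, U t (u i 0) = u i t := by
  have hV : ∀ t : ℝ, ∃ V : H →ₗᵢ[ℂ] H, ∀ i, V (u i 0) = u i t := fun t =>
    exists_linearIsometry_of_inner_eq (fun i j => by simpa using hu i j t 0 0) hd
  choose V hV using hV
  have hnorm : ∀ i t, ‖u i t‖ = ‖u i 0‖ := fun i t => by rw [← hV t, LinearIsometry.norm_map]
  have hadj : ∀ i s t x, inner ℂ (u i (t + s)) (V s x) = inner ℂ (u i t) x := by
    intro i s t x
    have h : (innerSL ℂ (u i (t + s))).comp (V s).toContinuousLinearMap = innerSL ℂ (u i t) := by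
      refine ContinuousLinearMap.ext_on hd ?_
      rintro _ ⟨j, rfl⟩
      simp only [ContinuousLinearMap.comp_apply, LinearIsometry.coe_toContinuousLinearMap,
        innerSL_apply_apply, hV]
      simpa using hu i j s t 0
    exact congrArg (fun L : H →L[ℂ] ℂ => L x) h
  have hshift : ∀ i s t, V s (u i t) = u i (s + t) := by
    intro i s t
    -- Only the vectors at time zero define `V s`. At other times the square of the distance is
    -- expanded: by `hadj` the cross term equals the common squared norm, so the distance is zero.
    rw [← sub_eq_zero, ← norm_eq_zero, ← sq_eq_zero_iff, norm_sub_rev, norm_sub_sq (𝕜 := ℂ),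
      add_comm s t, hadj, LinearIsometry.norm_map,
      inner_self_eq_norm_sq, hnorm i t, hnorm i (t + s)]
    ring
  have hmul : ∀ s t x, V (s + t) x = V s (V t x) := by
    intro s t x
    have h : (V (s + t)).toContinuousLinearMap =
        (V s).toContinuousLinearMap.comp (V t).toContinuousLinearMap := by
      refine ContinuousLinearMap.ext_on hd ?_
      rintro _ ⟨i, rfl⟩
      simp only [ContinuousLinearMap.comp_apply, LinearIsometry.coe_toContinuousLinearMap, hV,
        hshift]
    exact congrArg (fun L : H →L[ℂ] H => L x) h
  have hzero : ∀ x, V 0 x = x := by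
    intro x
    have h : (V 0).toContinuousLinearMap = ContinuousLinearMap.id ℂ H := by
      refine ContinuousLinearMap.ext_on hd ?_
      rintro _ ⟨i, rfl⟩
      simp [hV]
    exact congrArg (fun L : H →L[ℂ] H => L x) h
  have hsurj : ∀ t, Function.Surjective (V t) := fun t x =>
    ⟨V (-t) x, by rw [← hmul, add_neg_cancel, hzero]⟩
  refine ⟨fun t => LinearIsometryEquiv.ofSurjective (V t) (hsurj t), ?_, fun s t => ?_,
    fun f => ?_, fun i t => ?_⟩
  · ext x; simp [hzero]
  · ext x; simp [hmul]
  · simp only [LinearIsometryEquiv.coe_ofSurjective]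
    -- Isometries keep an approximation of `f` from the span equally good for all `t`, and on the
    -- span continuity comes from `hc`.
    refine continuous_of_uniform_approx_of_continuous fun v hv => ?_
    obtain ⟨ε, hε, hεv⟩ := Metric.mem_uniformity_dist.1 hv
    obtain ⟨g, hg, hfg⟩ := Metric.dense_iff.1 hd f ε hε
    refine ⟨fun t => V t g, ?_, fun t => hεv ?_⟩
    · refine Submodule.span_induction (p := fun g _ => Continuous fun t => V t g) ?_ ?_ ?_ ?_ hfg
      · rintro _ ⟨i, rfl⟩
        simpa only [hV] using hc i
      · simpa using continuous_const
      · intro x y _ _ hx hy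
        simp only [map_add]
        exact hx.add hy
      · intro c x _ hx
        simp only [map_smul]
        exact hx.const_smul c
    · rw [(V t).dist_map, dist_comm]
      exact hg
  · exact hV t i

end UnitaryGroup

/-! ### From pointwise derivatives to derivatives in norm. -/

/-- The mean value inequality bounds the difference quotients by the majorant of the pointwise
derivatives, and dominated convergence applies. -/
theorem Bargmann.hasDerivAt_of_dominated {u : ℝ → Bargmann} {F' : ℝ → ℂ → ℂ} {d : Bargmann}
    {t₀ K ρ : ℝ} (hρ : ρ < 1)
    (hu : ∀ t ∈ Set.Icc (t₀ - 1) (t₀ + 1), ∀ z, HasDerivAt (fun t => u t z) (F' t z) t)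
    (hd : ∀ z, d z = F' t₀ z)
    (hb : ∀ t ∈ Set.Icc (t₀ - 1) (t₀ + 1), ∀ z, ‖F' t z‖ ≤ majorant K ρ z) :
    HasDerivAt u d t₀ := by
  have h0 : t₀ ∈ Set.Icc (t₀ - 1) (t₀ + 1) := ⟨by linarith, by linarith⟩
  have hs : ∀ t z, (slope u t₀ t) z = slope (fun t => u t z) t₀ t := fun t z => by
    rw [slope_def_module, slope_def_module, ← Complex.coe_smul, smul_apply, sub_apply,
      Complex.real_smul]
  rw [hasDerivAt_iff_tendsto_slope]
  refine tendsto_of_dominated (memLp_majorant K hρ) ?_ fun z => ?_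
  · have hn : Set.Icc (t₀ - 1) (t₀ + 1) ∈ 𝓝[≠] t₀ :=
      mem_nhdsWithin_of_mem_nhds (Icc_mem_nhds (by linarith) (by linarith))
    filter_upwards [hn, self_mem_nhdsWithin] with t ht hne z
    have h := Convex.norm_image_sub_le_of_norm_hasDerivWithin_le
      (fun s hs => (hu s hs z).hasDerivWithinAt) (fun s hs => hb s hs z) (convex_Icc _ _) h0 ht
    have h1 : 0 < ‖t - t₀‖ := norm_pos_iff.2 (sub_ne_zero.2 hne)
    rw [hs, slope_def_module, norm_smul, norm_inv, inv_mul_le_iff₀ h1, mul_comm]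
    exact h
  · simp_rw [hs, hd]
    exact (hasDerivAt_iff_tendsto_slope).1 (hu t₀ h0 z)

theorem hasDerivAt_exp_quadratic {a b c a' b' c' : ℝ → ℂ} (ha : ∀ t, HasDerivAt a (a' t) t)
    (hb : ∀ t, HasDerivAt b (b' t) t) (hc : ∀ t, HasDerivAt c (c' t) t) (ha' : Continuous a')
    (hb' : Continuous b') (hc' : Continuous c') (h1 : ∀ t, ‖c t‖ < 1) {d : Bargmann} {t₀ : ℝ}
    (hd : ∀ z, d z = (a' t₀ + b' t₀ * z + c' t₀ * z ^ 2 / 2) *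
      cexp (a t₀ + b t₀ * z + c t₀ * z ^ 2 / 2)) :
    HasDerivAt (fun t => ofTame _ (Tame.exp_quadratic (a := a t) (b := b t) (h1 t))) d t₀ := by
  have hca : Continuous a := continuous_iff_continuousAt.2 fun t => (ha t).continuousAt
  have hcb : Continuous b := continuous_iff_continuousAt.2 fun t => (hb t).continuousAt
  have hcc : Continuous c := continuous_iff_continuousAt.2 fun t => (hc t).continuousAt
  have hI : IsCompact (Set.Icc (t₀ - 1) (t₀ + 1)) := isCompact_Icc
  have hne : (Set.Icc (t₀ - 1) (t₀ + 1)).Nonempty := ⟨t₀, by constructor <;> linarith⟩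
  -- The maximum of `‖c‖` on the window is attained, hence still below 1, and gives a uniform `ρ`.
  obtain ⟨s, -, hs⟩ := hI.exists_isMaxOn hne hcc.norm.continuousOn
  obtain ⟨M, hM⟩ := hI.exists_bound_of_continuousOn
    (f := fun t => ‖a t‖ + ‖b t‖ + ‖a' t‖ + ‖b' t‖ + ‖c' t‖)
    (Continuous.continuousOn (by fun_prop))
  set ρ := ‖c s‖
  refine Bargmann.hasDerivAt_of_dominated (K := M * Real.exp M + M + 1) (ρ := ρ) (h1 s)
    (F' := fun t z => (a' t + b' t * z + c' t * z ^ 2 / 2) *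
      cexp (a t + b t * z + c t * z ^ 2 / 2)) (fun t _ z => ?_) hd fun t ht z => ?_
  · have h := (((ha t).add ((hb t).mul_const z)).add (((hc t).mul_const (z ^ 2)).div_const 2)).cexp
    rw [mul_comm] at h
    exact h
  · have hMt := hM t ht
    rw [Real.norm_of_nonneg (by positivity)] at hMt
    have := norm_nonneg (a t)
    have := norm_nonneg (b t)
    have := norm_nonneg (a' t)
    have := norm_nonneg (b' t)
    have := norm_nonneg (c' t)
    have hM0 : 0 ≤ M := by linarith
    have hx := norm_nonneg z
    have hρ : ‖c t‖ ≤ ρ := hs ht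
    have e1 : ‖a' t + b' t * z + c' t * z ^ 2 / 2‖ ≤ M * Real.exp ‖z‖ := by
      calc _ ≤ ‖a' t‖ + ‖b' t‖ * ‖z‖ + ‖c' t‖ * ‖z‖ ^ 2 / 2 := by
            refine norm_add₃_le.trans ?_
            simp [norm_pow]
        _ ≤ M + M * ‖z‖ + M * ‖z‖ ^ 2 / 2 := by
            gcongr <;> linarith
        _ = M * (1 + ‖z‖ + ‖z‖ ^ 2 / 2) := by ring
        _ ≤ _ := by
            gcongr
            exact Real.quadratic_le_exp_of_nonneg hx
    have e2 : ‖cexp (a t + b t * z + c t * z ^ 2 / 2)‖ ≤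
        Real.exp (M + M * ‖z‖ + ρ * ‖z‖ ^ 2 / 2) := by
      rw [Complex.norm_exp]
      refine Real.exp_le_exp.2 ((Complex.re_le_norm _).trans ?_)
      calc _ ≤ ‖a t‖ + ‖b t‖ * ‖z‖ + ‖c t‖ * ‖z‖ ^ 2 / 2 := by
            refine norm_add₃_le.trans ?_
            simp [norm_pow]
        _ ≤ _ := by
            gcongr <;> linarith
    rw [norm_mul]
    calc _ ≤ (M * Real.exp ‖z‖) * Real.exp (M + M * ‖z‖ + ρ * ‖z‖ ^ 2 / 2) :=
          mul_le_mul e1 e2 (norm_nonneg _) (by positivity)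
      _ = (M * Real.exp M) * Real.exp ((M + 1) * ‖z‖ + ρ * ‖z‖ ^ 2 / 2) := by
          rw [mul_assoc, mul_assoc, ← Real.exp_add, ← Real.exp_add]
          ring_nf
      _ ≤ _ := by
          have hp : 0 ≤ M * Real.exp M := by positivity
          unfold majorant
          gcongr <;> linarith

/-! ### The squeeze generator on tame functions -/

/-- The differential expression `ξ z² / 2 - ξ̄ ∂² / 2`. -/
def gen (ξ : ℂ) (F : ℂ → ℂ) : ℂ → ℂ := fun z =>
  ξ / 2 * (z * (z * F z)) + -(conj ξ / 2) * deriv (deriv F) z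

theorem Tame.gen (ξ : ℂ) {F : ℂ → ℂ} (hF : Tame F) : Tame (gen ξ F) :=
  (hF.id_mul.id_mul.const_mul _).add (hF.deriv.deriv.const_mul _)

/-- Since `z` and `∂_z` are mutually adjoint on tame functions, so are `z²` and `∂_z²`; the
coefficients `ξ/2` and `-ξ̄/2` then make the expression skew-symmetric. -/
theorem inner_ofTame_gen {F G : ℂ → ℂ} (ξ : ℂ) (hF : Tame F) (hG : Tame G) :
    inner ℂ (ofTame _ (hF.gen ξ)) (ofTame G hG) = -inner ℂ (ofTame F hF) (ofTame _ (hG.gen ξ)) := by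
  have hmul : ∀ {F G : ℂ → ℂ} (hF : Tame F) (hG : Tame G),
      inner ℂ (ofTame F hF) (ofTame _ hG.id_mul) = inner ℂ (ofTame _ hF.deriv) (ofTame G hG) := by
    intro F G hF hG
    have := inner_eq_of_eq_deriv_add_mul (q := ofTame F hF) (f := ofTame G hG)
      (g := ofTame _ hG.id_mul) (r := ofTame _ hF.id_mul) (d := ofTame _ hF.deriv) (α := 0)
      (β := 1) (fun z => rfl) (fun z => rfl) (fun z => by simp)
    simpa using this
  have hdiv : ∀ {F G : ℂ → ℂ} (hF : Tame F) (hG : Tame G),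
      inner ℂ (ofTame F hF) (ofTame _ hG.deriv) = inner ℂ (ofTame _ hF.id_mul) (ofTame G hG) := by
    intro F G hF hG
    rw [← inner_conj_symm, ← hmul, inner_conj_symm]
  have e : ∀ {F : ℂ → ℂ} (hF : Tame F), ofTame _ (hF.gen ξ) =
      (ξ / 2) • ofTame _ hF.id_mul.id_mul + (-(conj ξ / 2)) • ofTame _ hF.deriv.deriv :=
    fun hF => Bargmann.ext fun z => rfl
  rw [e hF, e hG, inner_add_left, inner_add_right, inner_smul_left, inner_smul_left, inner_smul_right,
    inner_smul_right, ← hdiv hF.id_mul hG, ← hdiv hF hG.deriv,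
    ← hmul hF.deriv hG, ← hmul hF hG.id_mul]
  simp only [map_div₀, map_neg, conj_conj, map_ofNat]
  ring

theorem inner_gen {f g : Bargmann} (ξ : ℂ) (hf : Tame f) (hg : Tame g) :
    inner ℂ (ofTame _ (hf.gen ξ)) g = -inner ℂ f (ofTame _ (hg.gen ξ)) :=
  inner_ofTame_gen ξ hf hg

/-! ### The squeezed coherent states -/

/-- The parameter `ζ` of the squeeze operator at time `t`. -/
def zetaAt (ξ : ℂ) (t : ℝ) : ℂ := ((Real.tanh (t * ‖ξ‖) / ‖ξ‖ : ℝ) : ℂ) * ξ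

theorem zetaAt_one (ξ : ℂ) : zetaAt ξ 1 = zeta ξ := by simp [zetaAt, zeta]

theorem zetaAt_zero (ξ : ℂ) : zetaAt ξ 0 = 0 := by simp [zetaAt]

theorem conj_zetaAt (ξ : ℂ) (t : ℝ) : conj (zetaAt ξ t) = zetaAt (conj ξ) t := by
  simp only [zetaAt, map_mul, Complex.conj_ofReal, RCLike.norm_conj]

theorem norm_zetaAt (ξ : ℂ) (t : ℝ) : ‖zetaAt ξ t‖ = |Real.tanh (t * ‖ξ‖)| := by
  rw [zetaAt, norm_mul, Complex.norm_real, Real.norm_eq_abs, abs_div, abs_norm]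
  rcases eq_or_ne ξ 0 with rfl | h
  · simp
  · have := norm_ne_zero_iff.2 h
    field_simp

theorem norm_zetaAt_lt_one (ξ : ℂ) (t : ℝ) : ‖zetaAt ξ t‖ < 1 := by
  rw [norm_zetaAt]; exact Real.abs_tanh_lt_one _

theorem cosh_ne_zero (x : ℝ) : (Real.cosh x : ℂ) ≠ 0 := by
  exact_mod_cast (Real.cosh_pos x).ne'

theorem hasDerivAt_cosh_mul (r t : ℝ) :
    HasDerivAt (fun t => Real.cosh (t * r)) (r * Real.sinh (t * r)) t := by
  have := ((hasDerivAt_id' t).mul_const r).cosh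
  rw [one_mul, mul_comm] at this
  exact this

theorem hasDerivAt_zetaAt (ξ : ℂ) (t : ℝ) :
    HasDerivAt (zetaAt ξ) (ξ * ((Real.cosh (t * ‖ξ‖) ^ 2)⁻¹ : ℝ)) t := by
  have h1 : HasDerivAt (fun t : ℝ => Real.sinh (t * ‖ξ‖)) (‖ξ‖ * Real.cosh (t * ‖ξ‖)) t := by
    have := ((hasDerivAt_id' t).mul_const ‖ξ‖).sinh
    rw [one_mul, mul_comm] at this
    exact this
  have h2 := ((h1.div (hasDerivAt_cosh_mul ‖ξ‖ t) (Real.cosh_pos _).ne').div_const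
    ‖ξ‖).ofReal_comp.mul_const ξ
  have h3 : zetaAt ξ = fun t : ℝ =>
      ((Real.sinh (t * ‖ξ‖) / Real.cosh (t * ‖ξ‖) / ‖ξ‖ : ℝ) : ℂ) * ξ := by
    funext t
    rw [zetaAt, Real.tanh_eq_sinh_div_cosh]
  rw [h3]
  refine h2.congr_deriv ?_
  rcases eq_or_ne ξ 0 with rfl | h
  · simp
  · rw [mul_comm]
    congr 2
    have := norm_ne_zero_iff.2 h
    generalize t * ‖ξ‖ = x
    have := (Real.cosh_pos x).ne'
    field_simp
    exact Real.cosh_sq_sub_sinh_sq x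

theorem conj_mul_zetaAt (ξ : ℂ) (t : ℝ) :
    conj ξ * zetaAt ξ t = ((‖ξ‖ * Real.tanh (t * ‖ξ‖) : ℝ) : ℂ) := by
  rcases eq_or_ne ξ 0 with rfl | h
  · simp
  · have h1 := conj_mul' ξ
    have : (‖ξ‖ : ℂ) ≠ 0 := by exact_mod_cast norm_ne_zero_iff.2 h
    rw [zetaAt, mul_left_comm, h1]
    push_cast
    field_simp

theorem one_sub_tanh_sq (x : ℝ) : 1 - Real.tanh x ^ 2 = (Real.cosh x ^ 2)⁻¹ := by
  have := (Real.cosh_pos x).ne'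
  have := Real.cosh_sq x
  rw [Real.tanh_eq_sinh_div_cosh]
  field_simp
  linarith

theorem conj_zetaAt_mul_zetaAt (ξ : ℂ) (t : ℝ) :
    conj (zetaAt ξ t) * zetaAt ξ t = 1 - ((Real.cosh (t * ‖ξ‖) ^ 2)⁻¹ : ℝ) := by
  rw [conj_mul', norm_zetaAt, ← one_sub_tanh_sq, ← Complex.ofReal_pow, sq_abs]
  push_cast
  ring

/-- With `hasDerivAt_zetaAt` this says `ζ' = ξ - ξ̄ζ²`, the equation for the coefficient of `z²/2`
in the evolving Gaussian. -/
theorem riccati_zetaAt (ξ : ℂ) (t : ℝ) :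
    ξ - conj ξ * zetaAt ξ t ^ 2 = ξ * ((Real.cosh (t * ‖ξ‖) ^ 2)⁻¹ : ℝ) := by
  rcases eq_or_ne ξ 0 with rfl | h
  · simp
  · have h1 := conj_mul_zetaAt ξ t
    have h2 : zetaAt ξ t * ‖ξ‖ = Real.tanh (t * ‖ξ‖) * ξ := by
      have : (‖ξ‖ : ℂ) ≠ 0 := by exact_mod_cast norm_ne_zero_iff.2 h
      rw [zetaAt]
      push_cast
      field_simp
    rw [← one_sub_tanh_sq]
    push_cast at h1 h2 ⊢
    linear_combination (-zetaAt ξ t) * h1 - Complex.tanh (t * ‖ξ‖) * h2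

/-- The orbit of the coherent state `z ↦ e^{w z}` under the squeeze group. -/
def orbit (ξ w : ℂ) (t : ℝ) : Bargmann :=
  ofTame _ (Tame.exp_quadratic
    (a := ((-(1 / 2) * Real.log (Real.cosh (t * ‖ξ‖)) : ℝ) : ℂ) - conj (zetaAt ξ t) * (w ^ 2 / 2))
    (b := w * ((Real.cosh (t * ‖ξ‖))⁻¹ : ℝ)) (c := zetaAt ξ t) (norm_zetaAt_lt_one ξ t))

theorem orbit_apply (ξ w : ℂ) (t : ℝ) (z : ℂ) : orbit ξ w t z =
    cexp (((-(1 / 2) * Real.log (Real.cosh (t * ‖ξ‖)) : ℝ) : ℂ) -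
      conj (zetaAt ξ t) * (w ^ 2 / 2) + w * ((Real.cosh (t * ‖ξ‖))⁻¹ : ℝ) * z +
        zetaAt ξ t * z ^ 2 / 2) := rfl

theorem tame_orbit (ξ w : ℂ) (t : ℝ) : Tame (orbit ξ w t) := Tame.exp_quadratic
  (norm_zetaAt_lt_one ξ t)

theorem orbit_zero (ξ w : ℂ) : orbit ξ w 0 = coherent w := by
  refine Bargmann.ext fun z => ?_
  rw [orbit_apply, coherent_apply, zetaAt_zero]
  simp

theorem hasDerivAt_orbit_apply (ξ w : ℂ) (t : ℝ) (z : ℂ) :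
    HasDerivAt (orbit ξ w t)
      ((w * ((Real.cosh (t * ‖ξ‖))⁻¹ : ℝ) + zetaAt ξ t * z) * orbit ξ w t z) z := by
  have h := ((((hasDerivAt_id' z).const_mul (w * ((Real.cosh (t * ‖ξ‖))⁻¹ : ℝ))).const_add
    (((-(1 / 2) * Real.log (Real.cosh (t * ‖ξ‖)) : ℝ) : ℂ) -
      conj (zetaAt ξ t) * (w ^ 2 / 2))).fun_add
        (((hasDerivAt_pow 2 z).const_mul (zetaAt ξ t)).div_const 2)).cexp
  refine h.congr_deriv ?_
  rw [orbit_apply]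
  push_cast
  ring

theorem gen_orbit (ξ w : ℂ) (t : ℝ) (z : ℂ) : gen ξ (orbit ξ w t) z =
    (ξ / 2 * z ^ 2 - conj ξ / 2 * (zetaAt ξ t +
      (w * ((Real.cosh (t * ‖ξ‖))⁻¹ : ℝ) + zetaAt ξ t * z) ^ 2)) * orbit ξ w t z := by
  have h1 : deriv (orbit ξ w t) = fun z =>
      (w * ((Real.cosh (t * ‖ξ‖))⁻¹ : ℝ) + zetaAt ξ t * z) * orbit ξ w t z :=
    funext fun z => (hasDerivAt_orbit_apply ξ w t z).deriv
  have h2 := ((((hasDerivAt_id' z).const_mul (zetaAt ξ t)).const_add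
    (w * ((Real.cosh (t * ‖ξ‖))⁻¹ : ℝ))).fun_mul (hasDerivAt_orbit_apply ξ w t z)).deriv
  rw [gen, h1, h2]
  ring

/-- For `exp(a + bz + ζz²/2)` the evolution equation splits by powers of `z` into `a' = -ξ̄(ζ +
b²)/2`, `b' = -ξ̄ζb` and the Riccati equation. The `-½ log cosh` in `a` accounts for `-ξ̄ζ/2 = -½|ξ|
tanh(t|ξ|)`. -/
theorem hasDerivAt_orbit (ξ w : ℂ) (t : ℝ) :
    HasDerivAt (orbit ξ w) (ofTame _ ((tame_orbit ξ w t).gen ξ)) t := by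
  have hch : ∀ t : ℝ, Real.cosh (t * ‖ξ‖) ≠ 0 := fun t => (Real.cosh_pos _).ne'
  have hconj : ∀ t : ℝ, HasDerivAt (fun t => conj (zetaAt ξ t))
      (conj ξ * ((Real.cosh (t * ‖ξ‖) ^ 2)⁻¹ : ℝ)) t := fun t => by
    simp_rw [conj_zetaAt]
    simpa using hasDerivAt_zetaAt (conj ξ) t
  have hclosed : Continuous fun t : ℝ => (Real.cosh (t * ‖ξ‖) ^ 2)⁻¹ :=
    Continuous.inv₀ (by fun_prop) fun t => pow_ne_zero 2 (hch t)
  refine hasDerivAt_exp_quadratic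
    (a := fun t => ((-(1 / 2) * Real.log (Real.cosh (t * ‖ξ‖)) : ℝ) : ℂ) -
      conj (zetaAt ξ t) * (w ^ 2 / 2))
    (b := fun t => w * ((Real.cosh (t * ‖ξ‖))⁻¹ : ℝ)) (c := zetaAt ξ)
    (a' := fun t => ((-(1 / 2) * (‖ξ‖ * Real.sinh (t * ‖ξ‖) / Real.cosh (t * ‖ξ‖)) : ℝ) : ℂ) -
      conj ξ * ((Real.cosh (t * ‖ξ‖) ^ 2)⁻¹ : ℝ) * (w ^ 2 / 2))
    (b' := fun t => w * ((-(‖ξ‖ * Real.sinh (t * ‖ξ‖)) / Real.cosh (t * ‖ξ‖) ^ 2 : ℝ) : ℂ))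
    (c' := fun t => ξ * ((Real.cosh (t * ‖ξ‖) ^ 2)⁻¹ : ℝ))
    (fun t => ?_) (fun t => ?_) (fun t => hasDerivAt_zetaAt ξ t) ?_ ?_ ?_
    (norm_zetaAt_lt_one ξ) fun z => ?_
  · exact (((hasDerivAt_cosh_mul ‖ξ‖ t).log (hch t)).const_mul (-(1 / 2))).ofReal_comp.sub
      ((hconj t).mul_const _)
  · exact (((hasDerivAt_cosh_mul ‖ξ‖ t).inv (hch t)).ofReal_comp).const_mul w
  · have : Continuous fun t : ℝ => ‖ξ‖ * Real.sinh (t * ‖ξ‖) / Real.cosh (t * ‖ξ‖) :=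
      Continuous.div (by fun_prop) (by fun_prop) hch
    fun_prop
  · have : Continuous fun t : ℝ => -(‖ξ‖ * Real.sinh (t * ‖ξ‖)) / Real.cosh (t * ‖ξ‖) ^ 2 :=
      Continuous.div (by fun_prop) (by fun_prop) fun t => pow_ne_zero 2 (hch t)
    fun_prop
  · fun_prop
  · rw [ofTame_apply, gen_orbit, orbit_apply]
    congr 1
    have h1 := riccati_zetaAt ξ t
    have h2 := conj_mul_zetaAt ξ t
    rw [Real.tanh_eq_sinh_div_cosh] at h2
    have h3 : (Complex.cosh (t * ‖ξ‖)) ≠ 0 := by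
      have := cosh_ne_zero (t * ‖ξ‖)
      push_cast at this
      exact this
    push_cast at h1 h2 ⊢
    have h4 : -(‖ξ‖ * Complex.sinh (t * ‖ξ‖)) / Complex.cosh (t * ‖ξ‖) ^ 2 =
      -(conj ξ * zetaAt ξ t) * (Complex.cosh (t * ‖ξ‖))⁻¹ := by
      rw [h2]
      field_simp
    rw [← h1, mul_div_assoc (‖ξ‖ : ℂ), ← h2, h4]
    have h5 : (Complex.cosh (t * ‖ξ‖) ^ 2)⁻¹ = (Complex.cosh (t * ‖ξ‖))⁻¹ ^ 2 := by
      rw [inv_pow]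
    rw [h5]
    ring

theorem dense_span_coherent :
    Dense (Submodule.span ℂ (Set.range coherent) : Set Bargmann) := by
  rw [Submodule.dense_iff_topologicalClosure_eq_top, Submodule.topologicalClosure_eq_top_iff,
    Submodule.eq_bot_iff]
  intro f hf
  refine eq_of_forall_inner_coherent fun w => ?_
  rw [inner_zero_right]
  exact (Submodule.mem_orthogonal _ _).1 hf _ (Submodule.subset_span ⟨w, rfl⟩)

/-! ### Existence of the squeeze group. -/

/-- The derivative in `r` vanishes by skew-symmetry of the generator. -/
theorem inner_orbit_add (ξ v w : ℂ) (r s t : ℝ) :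
    inner ℂ (orbit ξ v (s + r)) (orbit ξ w (t + r)) = inner ℂ (orbit ξ v s) (orbit ξ w t) := by
  have h : ∀ r, HasDerivAt (fun r => inner ℂ (orbit ξ v (s + r)) (orbit ξ w (t + r))) 0 r := by
    intro r
    have h1 := ((hasDerivAt_orbit ξ v (s + r)).comp_const_add s r).inner ℂ
      ((hasDerivAt_orbit ξ w (t + r)).comp_const_add t r)
    refine h1.congr_deriv ?_
    rw [inner_gen ξ (tame_orbit ξ v _) (tame_orbit ξ w _), add_neg_cancel]
  have := is_const_of_deriv_eq_zero (fun r => (h r).differentiableAt) (fun r => (h r).deriv) r 0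
  simpa using this

theorem inner_eq_of_group {U : ℝ → Bargmann ≃ₗᵢ[ℂ] Bargmann} (h0 : U 0 = 1)
    (hadd : ∀ s t, U (s + t) = U s * U t) (t : ℝ) (f g : Bargmann) :
    inner ℂ f (U t g) = inner ℂ (U (-t) f) g := by
  rw [← (U (-t)).inner_map_map f]
  have : U (-t) (U t g) = g := by
    have h := hadd (-t) t
    rw [neg_add_cancel, h0] at h
    exact (congrArg (fun L : Bargmann ≃ₗᵢ[ℂ] Bargmann => L g) h).symm
  rw [this]

/-- `ξ K₊ - ξ̄ K₋` on polynomials. -/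
def genPoly (ξ : ℂ) (p : Polynomial ℂ) : Polynomial ℂ := ξ • Kplus p - conj ξ • Kminus p

theorem deriv_ofPoly (p : Polynomial ℂ) : deriv (ofPoly p) = ofPoly (Polynomial.derivative p) :=
  funext fun _ => Polynomial.deriv _

theorem ofPoly_genPoly (ξ : ℂ) (p : Polynomial ℂ) :
    ofPoly (genPoly ξ p) = ofTame _ ((Tame.poly p).gen ξ) := by
  refine Bargmann.ext fun z => ?_
  have h : deriv (deriv fun z => p.eval z) z =
      (Polynomial.derivative (Polynomial.derivative p)).eval z := by
    have := deriv_ofPoly (Polynomial.derivative p)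
    rw [← deriv_ofPoly] at this
    exact congrFun this z
  rw [ofTame_apply, gen, h, ofPoly_apply, genPoly, Kplus, Kminus]
  simp
  ring

/-- A weak derivative is upgraded to a strong one. Against coherent states, `U` can be moved to the
known orbits, which yields `U t f = f + ∫₀ᵗ U s g ds` with `g` the image of `f` under the generator;
the integrand is norm continuous. -/
theorem hasDerivAt_group {ξ : ℂ} {U : ℝ → Bargmann ≃ₗᵢ[ℂ] Bargmann} (h0 : U 0 = 1)
    (hadd : ∀ s t, U (s + t) = U s * U t) (hcont : ∀ f, Continuous fun t => U t f)
    (hU : ∀ w t, U t (coherent w) = orbit ξ w t) {f : Bargmann} (hf : Tame f) :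
    HasDerivAt (fun t => U t f) (ofTame _ (hf.gen ξ)) 0 := by
  set g := ofTame _ (hf.gen ξ)
  have hint : ∀ t : ℝ, HasDerivAt (fun t => ∫ s in (0 : ℝ)..t, U s g) (U t g) t := fun t =>
    ((hcont g).integral_hasStrictDerivAt 0 t).hasDerivAt
  have hw : ∀ w t, HasDerivAt (fun t => inner ℂ (coherent w) (U t f - ∫ s in (0 : ℝ)..t, U s g))
      0 t := by
    intro w t
    have h1 := ((hasDerivAt_orbit ξ w (-t)).scomp t (hasDerivAt_neg t)).inner ℂ
      (hasDerivAt_const t f)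
    have h2 := (hasDerivAt_const t (coherent w)).inner ℂ (hint t)
    have h3 := h1.sub h2
    have e : ∀ t, inner ℂ (coherent w) (U t f) = inner ℂ (orbit ξ w (-t)) f := fun t => by
      rw [inner_eq_of_group h0 hadd, hU]
    simp_rw [inner_sub_right, e]
    refine h3.congr_deriv ?_
    simp only [neg_smul, one_smul, inner_neg_left, inner_zero_right, inner_zero_left]
    rw [inner_gen ξ (tame_orbit ξ w (-t)) hf, inner_eq_of_group h0 hadd, hU]
    simp [g]
  have key : ∀ t, U t f = (∫ s in (0 : ℝ)..t, U s g) + f := by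
    intro t
    rw [← sub_eq_iff_eq_add']
    refine eq_of_forall_inner_coherent fun w => ?_
    have := is_const_of_deriv_eq_zero (fun t => (hw w t).differentiableAt)
      (fun t => (hw w t).deriv) t 0
    simpa [h0] using this
  have h := (hint 0).add_const f
  simp_rw [← key, h0] at h
  exact h

theorem exists_squeezeGroup (ξ : ℂ) : ∃ U : ℝ → Bargmann ≃ₗᵢ[ℂ] Bargmann,
    IsSqueezeGroup ξ U ∧ ∀ w t, U t (coherent w) = orbit ξ w t := by
  obtain ⟨U, h0, hadd, hcont, hU⟩ := exists_unitary_group (u := orbit ξ)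
    (fun v w r s t => inner_orbit_add ξ v w r s t)
    (by simpa only [orbit_zero] using dense_span_coherent)
    (fun w => continuous_iff_continuousAt.2 fun t => (hasDerivAt_orbit ξ w t).continuousAt)
  have hU' : ∀ w t, U t (coherent w) = orbit ξ w t := fun w t => by rw [← orbit_zero ξ, hU]
  refine ⟨U, ⟨h0, hadd, hcont, fun p => ?_⟩, hU'⟩
  have h := hasDerivAt_group h0 hadd hcont hU' (f := ofPoly p) (Tame.poly p)
  have e := ofPoly_genPoly ξ p
  rw [genPoly] at e
  rw [e]
  exact h

/-! ### Uniqueness of the squeeze group. -/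

/-- Approximation in the graph norm of the generator, which extends identities from polynomials to
tame functions. Truncation at `N + 2` becomes truncation at `N + 4` under `z²` and at `N` under
`∂_z²`. -/
theorem tendsto_genPoly_taylorPoly (ξ : ℂ) {f : Bargmann} (hf : Tame f) :
    Tendsto (fun N => ofPoly (genPoly ξ (taylorPoly (N + 2) f))) atTop
      (𝓝 (ofTame _ (hf.gen ξ))) := by
  have h1 := (tendsto_taylorPoly (ofTame _ hf.id_mul.id_mul)).comp (tendsto_add_atTop_nat 4)
  have h2 := tendsto_taylorPoly (ofTame _ hf.deriv.deriv)
  have h3 := (h1.const_smul (ξ / 2)).add (h2.const_smul (-(conj ξ / 2)))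
  have e1 : ofTame _ (hf.gen ξ) = (ξ / 2) • ofTame _ hf.id_mul.id_mul +
      (-(conj ξ / 2)) • ofTame _ hf.deriv.deriv := Bargmann.ext fun z => rfl
  rw [e1]
  refine h3.congr fun N => ?_
  have e2 : taylorPoly (N + 4) (ofTame _ hf.id_mul.id_mul) =
      Polynomial.X * (Polynomial.X * taylorPoly (N + 2) f) := by
    rw [X_mul_taylorPoly hf.1, X_mul_taylorPoly hf.id_mul.1]
    rfl
  have e3 : taylorPoly N (ofTame _ hf.deriv.deriv) =
      Polynomial.derivative (Polynomial.derivative (taylorPoly (N + 2) f)) := by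
    rw [derivative_taylorPoly, derivative_taylorPoly]
    rfl
  refine Bargmann.ext fun z => ?_
  simp only [Function.comp_apply, e2, e3, Bargmann.add_apply, Bargmann.smul_apply, ofPoly_apply,
    genPoly, Kplus, Kminus]
  simp
  ring

namespace IsSqueezeGroup

variable {ξ : ℂ} {V : ℝ → Bargmann ≃ₗᵢ[ℂ] Bargmann}

theorem hasDerivAt_ofPoly (hV : IsSqueezeGroup ξ V) (p : Polynomial ℂ) (t : ℝ) :
    HasDerivAt (fun t => V t (ofPoly p)) (V t (ofPoly (genPoly ξ p))) t := by
  have h1 : HasDerivAt (fun s => V (s - t) (ofPoly p)) (ofPoly (genPoly ξ p)) t := by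
    have h := hV.generator p
    rw [← sub_self t] at h
    exact h.comp_sub_const t t
  have h2 := ((V t).toContinuousLinearEquiv.toContinuousLinearMap.restrictScalars
    ℝ).hasFDerivAt.comp_hasDerivAt t h1
  refine h2.congr_of_eventuallyEq (Eventually.of_forall fun s => ?_)
  have h3 := hV.add t (s - t)
  rw [add_sub_cancel] at h3
  exact congrArg (fun L : Bargmann ≃ₗᵢ[ℂ] Bargmann => L (ofPoly p)) h3

/-- By unitarity the pairing of `V (r + h) p` with `V h q` does not depend on `h`; this is its
derivative at `h = 0`. -/
theorem inner_genPoly (hV : IsSqueezeGroup ξ V) (p q : Polynomial ℂ) (r : ℝ) :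
    inner ℂ (V r (ofPoly p)) (ofPoly (genPoly ξ q)) +
      inner ℂ (V r (ofPoly (genPoly ξ p))) (ofPoly q) = 0 := by
  have h1 : HasDerivAt (fun h => V (r + h) (ofPoly p)) (V r (ofPoly (genPoly ξ p))) 0 := by
    have h := hV.hasDerivAt_ofPoly p (r + 0)
    rw [add_zero] at h
    have h' := hV.hasDerivAt_ofPoly p r
    rw [← add_zero r] at h'
    simpa using h'.comp_const_add r 0
  have h2 := h1.inner ℂ (hV.generator q)
  have h3 : ∀ h, inner ℂ (V (r + h) (ofPoly p)) (V h (ofPoly q)) =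
      inner ℂ (V r (ofPoly p)) (ofPoly q) := fun h => by
    rw [add_comm, hV.add]
    exact (V h).inner_map_map _ _
  simp_rw [h3] at h2
  have h4 := h2.unique (hasDerivAt_const (0 : ℝ) (inner ℂ (V r (ofPoly p)) (ofPoly q)))
  rw [add_zero, hV.zero] at h4
  exact h4

/-- The group `V` is differentiable a priori only on polynomials, so it is compared with the orbit
through the pairing with `V t p`, which is constant in time. The difference is then orthogonal to
the range of `V t`, which is the whole space. -/
theorem apply_coherent (hV : IsSqueezeGroup ξ V) (w : ℂ) (t : ℝ) :
    V t (coherent w) = orbit ξ w t := by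
  have h1 : ∀ (p : Polynomial ℂ) {f : Bargmann} (hf : Tame f) (r : ℝ),
      inner ℂ (V r (ofPoly p)) (ofTame _ (hf.gen ξ)) +
        inner ℂ (V r (ofPoly (genPoly ξ p))) f = 0 := by
    intro p f hf r
    have l1 := tendsto_genPoly_taylorPoly ξ hf
    have l2 := (tendsto_taylorPoly f).comp (tendsto_add_atTop_nat 2)
    refine tendsto_nhds_unique ((tendsto_const_nhds.inner l1).add (tendsto_const_nhds.inner l2)) ?_
    refine tendsto_const_nhds.congr fun N => ?_
    exact (hV.inner_genPoly p _ r).symm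
  have h2 : ∀ p : Polynomial ℂ, inner ℂ (V t (ofPoly p)) (orbit ξ w t) =
      inner ℂ (ofPoly p) (coherent w) := by
    intro p
    have h : ∀ r, HasDerivAt (fun r => inner ℂ (V r (ofPoly p)) (orbit ξ w r)) 0 r := fun r => by
      refine ((hV.hasDerivAt_ofPoly p r).inner ℂ (hasDerivAt_orbit ξ w r)).congr_deriv ?_
      exact h1 p (tame_orbit ξ w r) r
    have := is_const_of_deriv_eq_zero (fun r => (h r).differentiableAt) (fun r => (h r).deriv) t 0
    simpa [hV.zero, orbit_zero] using this
  set d := orbit ξ w t - V t (coherent w) with hd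
  have h3 : ∀ f, inner ℂ (V t f) d = 0 := by
    intro f
    have l := ((V t).continuous.tendsto f).comp (tendsto_taylorPoly f)
    refine tendsto_nhds_unique (l.inner (tendsto_const_nhds (x := d))) ?_
    refine tendsto_const_nhds.congr fun N => ?_
    rw [Function.comp_apply, hd, inner_sub_right, h2, LinearIsometryEquiv.inner_map_map, sub_self]
  have h4 : inner ℂ d d = 0 := by
    have := h3 ((V t).symm d)
    rwa [LinearIsometryEquiv.apply_symm_apply] at this
  exact (sub_eq_zero.1 (inner_self_eq_zero.1 h4)).symm

end IsSqueezeGroup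

theorem linearIsometryEquiv_ext_coherent {V W : Bargmann ≃ₗᵢ[ℂ] Bargmann}
    (h : ∀ w, V (coherent w) = W (coherent w)) : V = W := by
  have h1 : V.toContinuousLinearEquiv.toContinuousLinearMap =
      W.toContinuousLinearEquiv.toContinuousLinearMap := by
    refine ContinuousLinearMap.ext_on dense_span_coherent ?_
    rintro _ ⟨w, rfl⟩
    exact h w
  exact LinearIsometryEquiv.ext fun f =>
    congrArg (fun L : Bargmann →L[ℂ] Bargmann => L f) h1

theorem existsUnique_squeezeGroup (ξ : ℂ) :
    ∃! U : ℝ → Bargmann ≃ₗᵢ[ℂ] Bargmann, IsSqueezeGroup ξ U := by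
  obtain ⟨U, hU, hU'⟩ := exists_squeezeGroup ξ
  refine ⟨U, hU, fun V hV => funext fun t => linearIsometryEquiv_ext_coherent fun w => ?_⟩
  rw [hV.apply_coherent, hU']

/-! ### The squeeze operator and its inverse. -/

theorem S_coherent (ξ w : ℂ) : S ξ (coherent w) = orbit ξ w 1 := by
  have h : ∃ U : ℝ → Bargmann ≃ₗᵢ[ℂ] Bargmann, IsSqueezeGroup ξ U :=
    (existsUnique_squeezeGroup ξ).exists
  rw [S, dif_pos h]
  exact h.choose_spec.apply_coherent w 1

theorem orbit_neg (ξ w : ℂ) (t : ℝ) : orbit (-ξ) w t = orbit ξ w (-t) := by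
  refine Bargmann.ext fun z => ?_
  have h : zetaAt (-ξ) t = zetaAt ξ (-t) := by simp [zetaAt, neg_div]
  simp only [orbit_apply, h, norm_neg, neg_mul, Real.cosh_neg]

theorem exists_group_S (ξ : ℂ) : ∃ U : ℝ → Bargmann ≃ₗᵢ[ℂ] Bargmann,
    IsSqueezeGroup ξ U ∧ S ξ = U 1 ∧ S (-ξ) = U (-1) := by
  obtain ⟨U, hU, hU'⟩ := exists_squeezeGroup ξ
  refine ⟨U, hU, linearIsometryEquiv_ext_coherent fun w => ?_,
    linearIsometryEquiv_ext_coherent fun w => ?_⟩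
  · rw [S_coherent, hU']
  · rw [S_coherent, hU', orbit_neg]

theorem S_S_neg (ξ : ℂ) (f : Bargmann) : S ξ (S (-ξ) f) = f := by
  obtain ⟨U, hU, h1, h2⟩ := exists_group_S ξ
  have h := hU.add 1 (-1)
  rw [add_neg_cancel, hU.zero] at h
  rw [h1, h2]
  exact (congrArg (fun L : Bargmann ≃ₗᵢ[ℂ] Bargmann => L f) h).symm

theorem S_neg_S (ξ : ℂ) (f : Bargmann) : S (-ξ) (S ξ f) = f := by
  have := S_S_neg (-ξ) f
  rwa [neg_neg] at this

theorem inner_S (ξ : ℂ) (f g : Bargmann) : inner ℂ f (S ξ g) = inner ℂ (S (-ξ) f) g := by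
  rw [← (S (-ξ)).inner_map_map f, S_neg_S]

theorem zeta_neg (ξ : ℂ) : zeta (-ξ) = -zeta ξ := by simp [zeta]

/-! ### Conjugation of first order operators. -/

/-- `z` times a squeezed coherent state. -/
def mulOrbit (ξ w : ℂ) : Bargmann := ofTame _ (tame_orbit ξ w 1).id_mul

theorem deriv_orbit (ξ w : ℂ) : ofTame _ (tame_orbit ξ w 1).deriv =
    (w * ((Real.cosh ‖ξ‖)⁻¹ : ℝ)) • orbit ξ w 1 + zeta ξ • mulOrbit ξ w := by
  refine Bargmann.ext fun z => ?_
  rw [ofTame_apply, (hasDerivAt_orbit_apply ξ w 1 z).deriv, Bargmann.add_apply,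
    Bargmann.smul_apply, Bargmann.smul_apply, mulOrbit, ofTame_apply, zetaAt_one, one_mul]
  ring

theorem S_apply (ξ : ℂ) (f : Bargmann) (v : ℂ) :
    S ξ f v = inner ℂ (orbit (-ξ) (conj v) 1) f := by
  rw [← inner_coherent, inner_S, S_coherent]

/-- Formally this is `∂_w` of the squeezed coherent state. It is obtained from the Hermitian
symmetry `h1` of the kernel of `S`, which turns the parameter into the variable of another orbit,
where the derivative is known. -/
theorem S_coherentDeriv (ξ w : ℂ) : S ξ (coherentDeriv w) =
    (((Real.cosh ‖ξ‖)⁻¹ : ℝ) : ℂ) • mulOrbit ξ w - (conj (zeta ξ) * w) • orbit ξ w 1 := by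
  refine Bargmann.ext fun v => ?_
  have h1 : orbit ξ w 1 v = conj (orbit (-ξ) (conj v) 1 (conj w)) := by
    rw [← S_coherent, S_apply, ← inner_conj_symm, ← inner_coherent (conj w), conj_conj]
  have h2 := inner_coherentDeriv (conj w) (orbit (-ξ) (conj v) 1)
  rw [conj_conj, (hasDerivAt_orbit_apply _ _ _ _).deriv] at h2
  rw [S_apply, ← inner_conj_symm, h2, Bargmann.sub_apply, Bargmann.smul_apply,
    Bargmann.smul_apply, mulOrbit, ofTame_apply, h1, zetaAt_one, zeta_neg, norm_neg, one_mul]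
  simp only [map_mul, map_add, map_neg, conj_conj, Complex.conj_ofReal]
  ring

theorem deriv_S (ξ : ℂ) (f : Bargmann) (v : ℂ) : deriv (S ξ f) v =
    ((Real.cosh ‖ξ‖)⁻¹ : ℝ) * inner ℂ (mulOrbit (-ξ) (conj v)) f + zeta ξ * (v * S ξ f v) := by
  rw [← inner_coherentDeriv, inner_S, S_coherentDeriv, inner_sub_left, inner_smul_left,
    inner_smul_left, S_apply, zeta_neg, norm_neg]
  simp only [map_mul, map_neg, conj_conj, Complex.conj_ofReal]
  ring

theorem conj_zeta_mul_zeta (ξ : ℂ) :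
    conj (zeta ξ) * zeta ξ = 1 - ((Real.cosh ‖ξ‖ : ℂ) ^ 2)⁻¹ := by
  have h := conj_zetaAt_mul_zetaAt ξ 1
  rw [zetaAt_one, one_mul] at h
  rw [h]
  push_cast
  rfl

/-- Conjugation by the squeeze operator acts linearly on the first order operators
`α ∂_z + β z`. -/
theorem S_apply_of_eq_deriv_add_mul (ξ : ℂ) {α β : ℂ} {f g : Bargmann}
    (h : ∀ z, g z = α * deriv f z + β * z * f z) (v : ℂ) :
    S ξ g v = (Real.cosh ‖ξ‖ : ℂ) * (α - β * conj (zeta ξ)) * deriv (S ξ f) v +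
      (Real.cosh ‖ξ‖ : ℂ) * (β - α * zeta ξ) * v * S ξ f v := by
  -- The operator is moved onto the kernel of `S`, which is tame, so nothing is needed of `f` beyond
  -- `g` lying in the space.
  have h1 := inner_eq_of_eq_deriv_add_mul (q := orbit (-ξ) (conj v) 1) (f := f) (g := g)
    (r := mulOrbit (-ξ) (conj v)) (d := ofTame _ (tame_orbit (-ξ) (conj v) 1).deriv)
    (α := α) (β := β) (fun z => rfl) (fun z => rfl) (fun z => by rw [h, mul_assoc])
  rw [deriv_S, S_apply ξ g, h1, deriv_orbit, inner_add_left, inner_smul_left, inner_smul_left,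
    ← S_apply, zeta_neg, norm_neg]
  have h2 := cosh_ne_zero ‖ξ‖
  have h3 := conj_zeta_mul_zeta ξ
  simp only [map_mul, map_neg, conj_conj, Complex.conj_ofReal]
  rw [Complex.ofReal_inv]
  generalize (Real.cosh ‖ξ‖ : ℂ) = C at *
  generalize inner ℂ (mulOrbit (-ξ) (conj v)) f = Y at *
  have h4 : C * C⁻¹ = 1 := mul_inv_cancel₀ h2
  have h5 : (C ^ 2)⁻¹ = C⁻¹ ^ 2 := by rw [inv_pow]
  rw [h5] at h3
  linear_combination (-(α - β * conj (zeta ξ)) * Y - β * v * S ξ f v * C⁻¹) * h4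
    + β * v * S ξ f v * C * h3

theorem inv_sqrt_one_sub_norm_zeta_sq (ξ : ℂ) :
    (Real.sqrt (1 - ‖zeta ξ‖ ^ 2))⁻¹ = Real.cosh ‖ξ‖ := by
  rw [← zetaAt_one, norm_zetaAt, one_mul, sq_abs, one_sub_tanh_sq, Real.sqrt_inv,
    Real.sqrt_sq (Real.cosh_pos _).le, inv_inv]

/-- The substitution on `(α, β)` attached to `-ξ` inverts the one attached to `ξ`, because `cosh²|ξ|
(1 - |ζ|²) = 1`. Each direction gives one inclusion of graphs, so domains agree as well. -/
theorem squeeze_eq_diffOp {ξ α β : ℂ} {T : Bargmann →ₗ.[ℂ] Bargmann}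
    (hT : ∀ f g : Bargmann, (f, g) ∈ T.graph ↔ ∀ z, g z = α * deriv f z + β * z * f z) :
    squeeze ξ T = diffOp ((Real.cosh ‖ξ‖ : ℂ) * (α - β * conj (zeta ξ)))
      ((Real.cosh ‖ξ‖ : ℂ) * (β - α * zeta ξ)) := by
  refine LinearPMap.eq_of_eq_graph (Submodule.ext fun ⟨f, g⟩ => ?_)
  rw [mem_graph_squeeze (S_S_neg ξ) (S_neg_S ξ), hT, mem_graph_diffOp]
  constructor
  · intro h v
    have := S_apply_of_eq_deriv_add_mul ξ h v
    rwa [S_S_neg, S_S_neg] at this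
  · intro h v
    have h1 := S_apply_of_eq_deriv_add_mul (-ξ) h v
    rw [zeta_neg, norm_neg] at h1
    have h2 := cosh_ne_zero ‖ξ‖
    have h3 := conj_zeta_mul_zeta ξ
    have h4 : (Real.cosh ‖ξ‖ : ℂ) ^ 2 * (1 - conj (zeta ξ) * zeta ξ) = 1 := by
      rw [h3]
      field_simp
      ring
    rw [h1, map_neg]
    linear_combination (α * deriv (S (-ξ) f) v + β * v * S (-ξ) f v) * h4

theorem squeeze_lowering (ξ : ℂ) : squeeze ξ lowering =
    diffOp (Real.cosh ‖ξ‖ : ℂ) (-((Real.cosh ‖ξ‖ : ℂ) * zeta ξ)) := by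
  have h := squeeze_eq_diffOp (ξ := ξ) (α := 1) (β := 0) (T := lowering)
    (fun f g => by rw [mem_graph_lowering]; simp)
  simpa using h

theorem squeeze_raising (ξ : ℂ) : squeeze ξ raising =
    diffOp (-((Real.cosh ‖ξ‖ : ℂ) * conj (zeta ξ))) (Real.cosh ‖ξ‖ : ℂ) := by
  have h := squeeze_eq_diffOp (ξ := ξ) (α := 0) (β := 1) (T := raising)
    (fun f g => by rw [mem_graph_raising]; simp)
  simpa using h

theorem squeeze_apply_of_graph {ξ : ℂ} {T : Bargmann →ₗ.[ℂ] Bargmann} {f g : Bargmann}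
    (h : (f, g) ∈ T.graph) :
    ∃ hf : S ξ f ∈ (squeeze ξ T).domain, squeeze ξ T ⟨S ξ f, hf⟩ = S ξ g := by
  have h1 : (S ξ f, S ξ g) ∈ (squeeze ξ T).graph := by
    rwa [mem_graph_squeeze (S_S_neg ξ) (S_neg_S ξ), S_neg_S, S_neg_S]
  obtain ⟨y, hy, hy'⟩ := (LinearPMap.mem_graph_iff _).1 h1
  simp only at hy hy'
  refine ⟨hy ▸ y.2, ?_⟩
  rw [← hy']
  exact congrArg _ (Subtype.ext hy.symm)

/-! ### The squeezed basis as explicit functions. -/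

theorem squeezedBasis_succ (ξ : ℂ) (n : ℕ) (z : ℂ) :
    squeezedBasis ξ (n + 1) z = ((Real.sqrt (n + 1) : ℝ) : ℂ)⁻¹ * (Real.cosh ‖ξ‖ *
      (z * squeezedBasis ξ n z - conj (zeta ξ) * deriv (squeezedBasis ξ n) z)) := by
  have h : ∀ z, (((Real.sqrt (n + 1) : ℝ) : ℂ) • Φ (n + 1)) z =
      0 * deriv (Φ n) z + 1 * z * Φ n z := fun z => by rw [id_mul_Φ]; ring
  have h1 := S_apply_of_eq_deriv_add_mul ξ h z
  rw [map_smul, Bargmann.smul_apply] at h1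
  have h2 := sqrt_succ_ne_zero n
  rw [squeezedBasis, eq_inv_mul_iff_mul_eq₀ h2, h1, squeezedBasis]
  ring

theorem squeezedBasis_apply (ξ : ℂ) (n : ℕ) :
    ∀ z, squeezedBasis ξ n z =
      (((Real.sqrt (n.factorial * (1 - ‖zeta ξ‖ ^ 2) ^ n))⁻¹ : ℝ) : ℂ) *
        ((fun (F : ℂ → ℂ) (w : ℂ) => w * F w - conj (zeta ξ) * deriv F w)^[n]
          (squeezedBasis ξ 0)) z := by
  have hpos : 0 ≤ 1 - ‖zeta ξ‖ ^ 2 := by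
    rw [← zetaAt_one, norm_zetaAt, sq_abs]
    linarith [Real.tanh_sq_lt_one (1 * ‖ξ‖)]
  induction n with
  | zero => intro z; simp
  | succ n ih =>
    intro z
    have hF : (squeezedBasis ξ n).toFun = _ := funext ih
    rw [squeezedBasis_succ, hF, Function.iterate_succ_apply', deriv_const_mul_field]
    have h1 : (Real.sqrt ((n + 1).factorial * (1 - ‖zeta ξ‖ ^ 2) ^ (n + 1)))⁻¹ =
        (Real.sqrt (n + 1))⁻¹ * (Real.cosh ‖ξ‖ *
          (Real.sqrt (n.factorial * (1 - ‖zeta ξ‖ ^ 2) ^ n))⁻¹) := by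
      rw [← inv_sqrt_one_sub_norm_zeta_sq, ← mul_inv, ← mul_inv, ← Real.sqrt_mul hpos,
        ← Real.sqrt_mul (by positivity), Nat.factorial_succ]
      push_cast
      ring_nf
    rw [h1]
    simp only [Complex.ofReal_mul, Complex.ofReal_inv]
    ring

theorem squeezedBasis_zero_apply (ξ z : ℂ) : squeezedBasis ξ 0 z =
    (((1 - ‖zeta ξ‖ ^ 2) ^ (1 / 4 : ℝ) : ℝ) : ℂ) * cexp (zeta ξ * z ^ 2 / 2) := by
  have h0 : Φ 0 = coherent 0 := Bargmann.ext fun z => by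
    rw [Φ_apply, coherent_apply]
    simp
  -- As `1 - |ζ|² = cosh⁻²|ξ|`, its fourth root is the factor `cosh^{-1/2}|ξ|` of the orbit.
  have h1 : (1 - ‖zeta ξ‖ ^ 2) ^ (1 / 4 : ℝ) = Real.exp (-(1 / 2) * Real.log (Real.cosh ‖ξ‖)) := by
    have hc := Real.cosh_pos ‖ξ‖
    rw [← zetaAt_one, norm_zetaAt, one_mul, sq_abs, one_sub_tanh_sq,
      Real.rpow_def_of_pos (by positivity), Real.log_inv, Real.log_pow]
    congr 1
    push_cast
    ring
  rw [squeezedBasis, h0, S_coherent, orbit_apply, zetaAt_one, one_mul, h1, Complex.ofReal_exp,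
    ← Complex.exp_add]
  congr 1
  push_cast
  ring

end Squeezed

end

theorem mainTheorem7 (ξ ζ : ℂ) (hζ : ζ = zeta ξ) :
    -- `S(ξ) = exp (ξ K₊ - ξ̄ K₋)` is well defined
    (∃! U : ℝ → Bargmann ≃ₗᵢ[ℂ] Bargmann, IsSqueezeGroup ξ U) ∧
    -- the squeezed ladder operators act on the squeezed basis as ladder operators
    (∃ h : squeezedBasis ξ 0 ∈ (squeeze ξ lowering).domain,
      squeeze ξ lowering ⟨squeezedBasis ξ 0, h⟩ = 0) ∧
    (∀ n : ℕ, ∃ h : squeezedBasis ξ (n + 1) ∈ (squeeze ξ lowering).domain,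
      squeeze ξ lowering ⟨squeezedBasis ξ (n + 1), h⟩ =
        ((Real.sqrt (n + 1) : ℝ) : ℂ) • squeezedBasis ξ n) ∧
    (∀ n : ℕ, ∃ h : squeezedBasis ξ n ∈ (squeeze ξ raising).domain,
      squeeze ξ raising ⟨squeezedBasis ξ n, h⟩ =
        ((Real.sqrt (n + 1) : ℝ) : ℂ) • squeezedBasis ξ (n + 1)) ∧
    -- as operators on the Bargmann space, equality of domains included
    squeeze ξ lowering =
      diffOp (((Real.sqrt (1 - ‖ζ‖ ^ 2))⁻¹ : ℝ) : ℂ) (-((((Real.sqrt (1 - ‖ζ‖ ^ 2))⁻¹ : ℝ) : ℂ) * ζ)) ∧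
    squeeze ξ raising =
      diffOp (-((((Real.sqrt (1 - ‖ζ‖ ^ 2))⁻¹ : ℝ) : ℂ) * conj ζ)) (((Real.sqrt (1 - ‖ζ‖ ^ 2))⁻¹ : ℝ) : ℂ) ∧
    -- the squeezed basis vectors as functions
    (∀ n : ℕ, ∀ z : ℂ, squeezedBasis ξ n z =
      (((Real.sqrt (n.factorial * (1 - ‖ζ‖ ^ 2) ^ n))⁻¹ : ℝ) : ℂ) *
        ((fun (F : ℂ → ℂ) (w : ℂ) => w * F w - conj ζ * deriv F w)^[n] (squeezedBasis ξ 0)) z) ∧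
    (∀ z : ℂ, squeezedBasis ξ 0 z =
      (((1 - ‖ζ‖ ^ 2) ^ (1 / 4 : ℝ) : ℝ) : ℂ) * Complex.exp (ζ * z ^ 2 / 2)) := by
  subst hζ
  rw [inv_sqrt_one_sub_norm_zeta_sq]
  refine ⟨existsUnique_squeezeGroup ξ, ?_, fun n => ?_, fun n => ?_, squeeze_lowering ξ,
    squeeze_raising ξ, squeezedBasis_apply ξ, squeezedBasis_zero_apply ξ⟩
  · have h := squeeze_apply_of_graph (ξ := ξ)
      (mem_graph_lowering.2 fun w => deriv_Φ 0 w)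
    simpa [squeezedBasis] using h
  · have h := squeeze_apply_of_graph (ξ := ξ)
      (mem_graph_lowering.2 fun w => deriv_Φ (n + 1) w)
    rw [map_smul] at h
    simpa [squeezedBasis] using h
  · have h := squeeze_apply_of_graph (ξ := ξ)
      (mem_graph_raising.2 fun w => id_mul_Φ n w)
    rw [map_smul] at h
    exact h
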